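/- Let $k$ be an algebraically closed field of characteristic $p>0$, let $q=p^{e}$ with $e\ge 1$, let $m\ge 2$ be an integer with $p\nmid m$, and let $n\ge 1$. Put $K=k(t)$, let $G$ be the regular projective model of the affine curve $\{u^q=x^m+t\}\subset\mathbb A^2_K$, and let $G^n$ be its $n$-th fibre power over $K$, so that $$K(G^n)=\operatorname{Frac}\bigl(K[x_1,\dots,x_n,u_1,\dots,u_n]/(u_i^q-x_i^m-t:\ 1\le i\le n)\bigr).$$ Let $\mathcal Y$ be the normalisation of $\mathbb P^n_k\times\mathbb A^1_t$ in $K(G^n)$, where $K(G^n)$ is an extension of the function field $k(t)(y_1,\dots,y_n)$ of $\mathbb P^n_k\times\mathbb A^1_t$, with $y_i=Y_i/Y_0$ for homogeneous coordinates $Y_0,\dots,Y_n$ of $\mathbb P^n$, via $y_i\mapsto x_i^{-1}$. For integers $a_1,\dots,a_n$ let $\mathbb A^n/\tfrac1q(a_1,\dots,a_n)$ be the affine toric variety over $k$ of the cone $\sum_{i=1}^n\mathbb R_{\ge0}e_i$ with respect to the lattice $\sum_{i=1}^n\mathbb Z e_i+\mathbb Z\cdot\tfrac1q(a_1e_1+\dots+a_ne_n)\subset\mathbb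 R^n$, and let $0$ be its torus-fixed point. Then étale locally every singularity of $\mathcal Y$ is of the form $$\mathbb A^n/\tfrac1q(1,m_1,\dots,m_{n-1})\times\mathbb A^1,\qquad m_1,\dots,m_{n-1}\in\{1,-m\}.$$ That is, for every point $y\in\mathcal Y$ whose local ring is not regular there are $m_1,\dots,m_{n-1}\in\{1,-m\}$, a $k$-scheme $U$ with a point $w\in U$, and étale $k$-morphisms $f\colon U\to\mathcal Y$ and $g\colon U\to\mathbb A^n/\tfrac1q(1,m_1,\dots,m_{n-1})\times\mathbb A^1$ such that $f(w)=y$ and $g(w)\in\{0\}\times\mathbb A^1$. -/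

import Mathlib

open AlgebraicGeometry CategoryTheory

universe u

noncomputable section

namespace ProductOfCurves

/-! ### The function field of the product `Gⁿ` -/

/-- The coordinate ring `K[x₁, …, xₙ, u₁, …, uₙ] / (uᵢ^q - xᵢ^m - t)` over `K = k(t)` of the `n`-th
fibre power over `K` of the affine curve `Gₓ = {u^q = x^m + t}`. The variable `Sum.inl i` is `xᵢ`
and `Sum.inr i` is `uᵢ`. -/
abbrev CoordRing (k : Type u) [Field k] (n m q : ℕ) : Type u :=
  MvPolynomial (Fin n ⊕ Fin n) (RatFunc k) ⧸
    Ideal.span (Set.range fun i : Fin n =>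
      (MvPolynomial.X (Sum.inr i) ^ q - MvPolynomial.X (Sum.inl i) ^ m - MvPolynomial.C RatFunc.X :
        MvPolynomial (Fin n ⊕ Fin n) (RatFunc k)))

/-- The function field `K(Gⁿ)`, where `G` is the regular projective model of `Gₓ`; it is the field
of fractions of the coordinate ring of the dense open subvariety `(Gₓ)ⁿ` of `Gⁿ`. -/
abbrev FunField (k : Type u) [Field k] (n m q : ℕ) : Type u :=
  FractionRing (CoordRing k n m q)

/-- The rational function `xᵢ` on `Gⁿ`. -/
def x (k : Type u) [Field k] (n m q : ℕ) (i : Fin n) : FunField k n m q :=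
  algebraMap (CoordRing k n m q) _ (Ideal.Quotient.mk _ (MvPolynomial.X (Sum.inl i)))

/-- The inclusion `k[t] → K = k(t) → K(Gⁿ)`. -/
def baseHom (k : Type u) [Field k] (n m q : ℕ) : Polynomial k →+* FunField k n m q :=
  (algebraMap (CoordRing k n m q) (FunField k n m q)).comp
    ((Ideal.Quotient.mk _).comp
      ((MvPolynomial.C (σ := Fin n ⊕ Fin n)).comp (algebraMap (Polynomial k) (RatFunc k))))

/-! ### The normalisation of `ℙⁿ × 𝔸¹` in `K(Gⁿ)` -/

/-- The standard grading of `k[t][Y₀, …, Yₙ]`, with `k[t]` in degree `0`. -/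
abbrev grading (k : Type u) [Field k] (n : ℕ) :
    ℕ → Submodule (Polynomial k) (MvPolynomial (Fin (n + 1)) (Polynomial k)) :=
  MvPolynomial.homogeneousSubmodule (Fin (n + 1)) (Polynomial k)

instance gradedAlgebraGrading (k : Type u) [Field k] (n : ℕ) : GradedAlgebra (grading k n) :=
  MvPolynomial.gradedAlgebra

/-- `ℙⁿ_k × 𝔸¹_t`, that is, projective `n`-space over `k[t]`. -/
abbrev ProjTimesLine (k : Type u) [Field k] (n : ℕ) : Scheme.{u} :=
  Proj (grading k n)

/-- The structure morphism `ℙⁿ_k × 𝔸¹_t ⟶ 𝔸¹_t ⟶ Spec k`. -/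
def projToBase (k : Type u) [Field k] (n : ℕ) :
    ProjTimesLine k n ⟶ Spec (CommRingCat.of k) :=
  Proj.toSpecZero (grading k n) ≫
    Spec.map (CommRingCat.ofHom
      ((algebraMap (Polynomial k) (grading k n 0)).comp (Polynomial.C (R := k))))

/-- Evaluation of polynomials in `k[t][Y₀, …, Yₙ]` at
`(1, y₁, …, yₙ)`, where `yᵢ = xᵢ⁻¹ ∈ K(Gⁿ)` (`xᵢ` is invertible there). -/
def evalHom (k : Type u) [Field k] (n m q : ℕ) :
    MvPolynomial (Fin (n + 1)) (Polynomial k) →+* FunField k n m q :=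
  MvPolynomial.eval₂Hom (baseHom k n m q)
    (Fin.cons 1 fun i => Ring.inverse (x k n m q i))

/-- `evalHom`, with values in the global functions on `Spec K(Gⁿ)`. -/
def evalHomSpec (k : Type u) [Field k] (n m q : ℕ) :
    MvPolynomial (Fin (n + 1)) (Polynomial k) →+*
      Γ(Spec (CommRingCat.of (FunField k n m q)), ⊤) :=
  (Scheme.ΓSpecIso (CommRingCat.of (FunField k n m q))).inv.hom.comp (evalHom k n m q)

theorem irrelevant_map (k : Type u) [Field k] (n m q : ℕ) :
    ((HomogeneousIdeal.irrelevant (grading k n)).toIdeal.map (evalHomSpec k n m q)) = ⊤ := by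
  rw [Ideal.eq_top_iff_one]
  have h : evalHomSpec k n m q (MvPolynomial.X 0) = 1 := by
    simp [evalHomSpec, evalHom]
  rw [← h]
  refine Ideal.mem_map_of_mem _ ?_
  change MvPolynomial.X 0 ∈ HomogeneousIdeal.irrelevant (grading k n)
  rw [HomogeneousIdeal.mem_irrelevant_iff]
  have h1 : (MvPolynomial.X 0 : MvPolynomial (Fin (n + 1)) (Polynomial k)) ∈ grading k n 1 :=
    MvPolynomial.isHomogeneous_X _ _
  rw [GradedRing.proj_apply]
  exact DirectSum.decompose_of_mem_ne (grading k n) h1 one_ne_zero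

/-- The morphism `Spec K(Gⁿ) ⟶ ℙⁿ_k × 𝔸¹_t` given by the point `[1 : y₁ : ⋯ : yₙ]` over `k[t]`. -/
def point (k : Type u) [Field k] (n m q : ℕ) :
    Spec (CommRingCat.of (FunField k n m q)) ⟶ ProjTimesLine k n :=
  Proj.fromOfGlobalSections (grading k n) (evalHomSpec k n m q) (irrelevant_map k n m q)

/-- The scheme `𝒴`, the normalisation of `ℙⁿ_k × 𝔸¹_t` in `K(Gⁿ)`. -/
def Y (k : Type u) [Field k] (n m q : ℕ) : Scheme.{u} :=
  (point k n m q).normalization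

/-- The structure morphism `𝒴 ⟶ Spec k`. -/
def YToBase (k : Type u) [Field k] (n m q : ℕ) : Y k n m q ⟶ Spec (CommRingCat.of k) :=
  (point k n m q).fromNormalization ≫ projToBase k n

/-! ### Toric quotient singularities -/

/-- The semigroup `σ^∨ ∩ M` of a lattice `N ⊆ ℝⁿ` and a cone `σ ⊆ ℝⁿ`, where `M = Hom(N, ℤ)` is
identified with the set of vectors that have integral scalar product with every element of `N`. -/
def dualSemigroup {n : ℕ} (N : AddSubgroup (Fin n → ℝ)) (σ : PointedCone ℝ (Fin n → ℝ)) :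
    AddSubmonoid (Fin n → ℝ) where
  carrier := {w | (∀ v ∈ N, ∃ c : ℤ, w ⬝ᵥ v = c) ∧ ∀ v ∈ σ, 0 ≤ w ⬝ᵥ v}
  zero_mem' := ⟨fun _ _ => ⟨0, by simp⟩, fun _ _ => by simp⟩
  add_mem' := by
    rintro w w' ⟨h1, h2⟩ ⟨h1', h2'⟩
    refine ⟨fun v hv => ?_, fun v hv => ?_⟩
    · obtain ⟨c, hc⟩ := h1 v hv
      obtain ⟨c', hc'⟩ := h1' v hv
      exact ⟨c + c', by rw [add_dotProduct, hc, hc']; push_cast; rfl⟩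
    · rw [add_dotProduct]
      exact add_nonneg (h2 v hv) (h2' v hv)

/-- The lattice `∑ ℤ eᵢ + ℤ · (1/q) (a₁, …, aₙ)`. -/
def quotLattice {n : ℕ} (q : ℕ) (a : Fin n → ℤ) : AddSubgroup (Fin n → ℝ) :=
  AddSubgroup.closure (Set.range fun i : Fin n => (Pi.single i 1 : Fin n → ℝ)) ⊔
    AddSubgroup.zmultiples fun i => (a i : ℝ) / (q : ℝ)

/-- The cone `∑ ℝ≥0 eᵢ`. -/
def orthant (n : ℕ) : PointedCone ℝ (Fin n → ℝ) :=
  PointedCone.hull ℝ (Set.range fun i : Fin n => (Pi.single i 1 : Fin n → ℝ))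

/-- The coordinate ring `k[σ^∨ ∩ M]` of the toric variety `𝔸ⁿ / (1/q)(a₁, …, aₙ)`. -/
abbrev QuotRing (k : Type u) [Field k] {n : ℕ} (q : ℕ) (a : Fin n → ℤ) : Type u :=
  AddMonoidAlgebra k (dualSemigroup (quotLattice q a) (orthant n))

/-- The product `𝔸ⁿ / (1/q)(a₁, …, aₙ) × 𝔸¹`. -/
abbrev QuotTimesLine (k : Type u) [Field k] {n : ℕ} (q : ℕ) (a : Fin n → ℤ) : Scheme.{u} :=
  Spec (CommRingCat.of (Polynomial (QuotRing k q a)))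

/-- The structure morphism `𝔸ⁿ / (1/q)(a₁, …, aₙ) × 𝔸¹ ⟶ Spec k`. -/
def quotToBase (k : Type u) [Field k] {n : ℕ} (q : ℕ) (a : Fin n → ℤ) :
    QuotTimesLine k q a ⟶ Spec (CommRingCat.of k) :=
  Spec.map (CommRingCat.ofHom (algebraMap k (Polynomial (QuotRing k q a))))

/-- The line `{0} × 𝔸¹`, where `0` is the torus-fixed point of `𝔸ⁿ / (1/q)(a₁, …, aₙ)`, at which
all characters in the semigroup other than the trivial one vanish. -/
def vertexLine (k : Type u) [Field k] {n : ℕ} (q : ℕ) (a : Fin n → ℤ) :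
    Set (QuotTimesLine k q a) :=
  PrimeSpectrum.zeroLocus
    {f | ∃ s : dualSemigroup (quotLattice q a) (orthant n), s ≠ 0 ∧
      f = Polynomial.C (AddMonoidAlgebra.single s (1 : k))}

/-! ### Singular points and étale neighbourhoods -/

/-- A point of a scheme is singular if its local ring is not regular. -/
def IsSingularPt (X : Scheme.{u}) (y : X) : Prop :=
  ¬ IsRegularLocalRing (X.presheaf.stalk y)

/-- The pointed `S`-schemes `(X, y)` and `(T, z)` are étale locally the same: they have a common
étale neighbourhood over `S`. -/
def EtaleLocallySame {S X T : Scheme.{u}} (sX : X ⟶ S) (sT : T ⟶ S) (y : X) (z : T) : Prop :=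
  ∃ (U : Scheme.{u}) (f : U ⟶ X) (g : U ⟶ T) (w : U),
    Etale f ∧ Etale g ∧ f ≫ sX = g ≫ sT ∧ f w = y ∧ g w = z

end ProductOfCurves

end

/-! Put q = p^e and choose natural numbers a, b with q b = 1 + m a. Each standard chart of ℙⁿ × 𝔸¹
is Spec A for a polynomial ring A in n + 1 variables. The field K(Gⁿ) is purely inseparable over
Frac A, and the corresponding chart of 𝒴 is Spec R, where R is the integral closure of A in K(Gⁿ).

The proof changes coordinates étale locally. Let ψ be functions on Spec A that are étale coordinates
on a locus d ≠ 0, and let T be a normal domain with T^q ⊆ k[ψ] ⊆ T such that A and T generate the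
field K(Gⁿ). Integral closure commutes with étale base change, so R[1/d] is T ⊗ A[1/d] over k[ψ],
which is étale over T (`exists_etale_localization`). Hence 𝒴 looks locally like Spec T, and it
remains to find ψ and T at each point.

On the chart Y₀ ≠ 0 put yᵢ = xᵢ⁻¹ and gᵢ = 1 + t yᵢ^m, so that uᵢ^q yᵢ^m = gᵢ. Where yᵢ vanishes, gᵢ
is invertible and (uᵢ^a yᵢ^b)^q = yᵢ gᵢ^a is a coordinate. Where yᵢ is invertible, (uᵢ yᵢ^m)^q =
yᵢ^(qm-m) gᵢ is a coordinate. So T is a polynomial ring and these points are regular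
(`IsProductField.isRegularLocalRing_chart`).

At infinity, permute the indices so that the chart is the one where x₀ is a coordinate and vanishes
at the point. The other coordinates are zᵢ = x₀ / xᵢ and u₀^q = x₀^m + t, which replaces t.
Frobenius eliminates t: (uᵢ - u₀)^q zᵢ^m = x₀^m (1 - zᵢ^m). The same two substitutions now give gᵢ
with x₀^αᵢ gᵢ^q a coordinate, where αᵢ = 1 if zᵢ vanishes and αᵢ = -m otherwise. The products x₀^(∑
αᵢcᵢ/q) ∏ gᵢ^cᵢ with q ∣ ∑ αᵢcᵢ are the characters of the toric variety, so T = k[σ^∨ ∩ M][u₀]. The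
point lies over the vertex if every zᵢ (1 - zᵢ^m) vanishes there
(`IsProductField.isToricAt_infinity`).

If zⱼ (1 - zⱼ^m) is invertible for some j, then r = (1 - zⱼ^m) / (uⱼ - u₀) satisfies r^q x₀^m =
unit. Multiplying the uᵢ - u₀ by r removes x₀ from the equations, T is a polynomial ring again, and
the point is regular (`IsProductField.isRegularLocalRing_infinity`). -/

noncomputable section

namespace ProductOfCurves

/-! ### Étale algebras over regular and over polynomial rings -/

open TensorProduct IsLocalRing

/-- The local rings of an étale algebra over a regular ring are regular. -/
theorem isRegularLocalRing_of_etale (T : Type*) {S : Type*} [CommRing T] [CommRing S] [Algebra T S]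
    [Algebra.Etale T S] [IsRegularRing T] (P : Ideal S) [P.IsPrime] :
    IsRegularLocalRing (Localization.AtPrime P) := by
  have : IsNoetherianRing S := Algebra.FiniteType.isNoetherianRing T S
  have : IsNoetherianRing (Localization.AtPrime P) :=
    IsLocalization.isNoetherianRing P.primeCompl _ inferInstance
  have hreg := IsRegularRing.isRegularLocalRing_localization (P.under T)
  let : Algebra (Localization.AtPrime (P.under T)) (Localization.AtPrime P) :=
    (Localization.localRingHom (P.under T) P (algebraMap T S) rfl).toAlgebra
  have : Localization.AtPrime.IsLiesOverAlgebra (P.under T) P := ⟨rfl⟩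
  have hmap := ((Algebra.isUnramifiedAt_iff_map_eq T (P.under T) P).mp inferInstance).2
  have hmap' : (maximalIdeal (Localization.AtPrime (P.under T))).map
      (algebraMap _ (Localization.AtPrime P)) = maximalIdeal _ := by
    rw [← hmap, ← Localization.AtPrime.map_eq_maximalIdeal, Ideal.map_map,
      ← IsScalarTower.algebraMap_eq]
  refine IsRegularLocalRing.of_spanFinrank_maximalIdeal_le _ ?_
  have h1 : (maximalIdeal (Localization.AtPrime P)).spanFinrank ≤
      (maximalIdeal (Localization.AtPrime (P.under T))).spanFinrank := by
    rw [← hmap']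
    exact Ideal.spanFinrank_map_le_of_fg _ (IsNoetherian.noetherian _)
  -- Étale algebras are flat, so going-down holds and heights do not drop.
  have h2 : (P.under T).height ≤ P.height := by
    rw [Ideal.height_eq_height_add_of_liesOver_of_hasGoingDown (P.under T) P]
    exact le_self_add
  calc ((maximalIdeal (Localization.AtPrime P)).spanFinrank : WithBot ℕ∞)
      ≤ (maximalIdeal (Localization.AtPrime (P.under T))).spanFinrank := by exact_mod_cast h1
    _ = ringKrullDim (Localization.AtPrime (P.under T)) := hreg.spanFinrank_maximalIdeal
    _ ≤ ringKrullDim (Localization.AtPrime P) := by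
      rw [IsLocalization.AtPrime.ringKrullDim_eq_height (P.under T),
        IsLocalization.AtPrime.ringKrullDim_eq_height P]
      exact_mod_cast h2

/-- A localization of a polynomial ring that is unramified over a polynomial ring in the same
number of variables is étale over it. -/
theorem etale_of_formallyUnramified {σ : Type} {k A₁ T₀ : Type u} [Field k] [Finite σ] [CommRing A₁]
    [Algebra k A₁] [Algebra (MvPolynomial σ k) A₁] [IsScalarTower k (MvPolynomial σ k) A₁]
    [CommRing T₀] [Algebra k T₀] (e : MvPolynomial σ k ≃ₐ[k] T₀)
    [Algebra T₀ A₁] [IsScalarTower k T₀ A₁] (d : MvPolynomial σ k) [IsLocalization.Away d A₁]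
    [Algebra.FormallyUnramified T₀ A₁] :
    Algebra.Etale T₀ A₁ := by
  cases nonempty_fintype σ
  have h0 : Algebra.Smooth k (MvPolynomial σ k) :=
    { formallySmooth := inferInstance, finitePresentation := inferInstance }
  have h1 : Algebra.Smooth (MvPolynomial σ k) A₁ := .of_isLocalization_Away d
  have h2 : Algebra.Smooth k A₁ := .comp k (MvPolynomial σ k) A₁
  have hE : Algebra.Etale (MvPolynomial σ k) A₁ := .of_isLocalizationAway d
  have hft : Algebra.FiniteType T₀ A₁ := .of_restrictScalars_finiteType k T₀ A₁
  have hN : IsNoetherianRing T₀ := isNoetherianRing_of_ringEquiv _ e.toRingEquiv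
  let b₂ : Module.Basis σ A₁ Ω[A₁⁄k] := ((KaehlerDifferential.mvPolynomialBasis k σ).baseChange
    A₁).map (KaehlerDifferential.tensorKaehlerEquivOfFormallyEtale k (MvPolynomial σ k) A₁)
  have hinj : Function.Injective (KaehlerDifferential.mapBaseChange k T₀ A₁) := by
    let : Algebra (MvPolynomial σ k) T₀ := e.toRingHom.toAlgebra
    have htow : IsScalarTower k (MvPolynomial σ k) T₀ :=
      .of_algebraMap_eq fun r => (e.commutes r).symm
    have : Algebra.FormallyEtale (MvPolynomial σ k) T₀ :=
      .of_equiv (AlgEquiv.ofRingEquiv (f := e.toRingEquiv) fun _ => rfl)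
    let b₁ : Module.Basis σ A₁ (A₁ ⊗[T₀] Ω[T₀⁄k]) :=
      ((KaehlerDifferential.mvPolynomialBasis k σ).baseChange T₀).map
        (KaehlerDifferential.tensorKaehlerEquivOfFormallyEtale k (MvPolynomial σ k) T₀)
        |>.baseChange A₁
    let eqv := b₁.equiv b₂ (Equiv.refl σ)
    -- As Ω[A₁⁄T₀] = 0, this is a surjection between free modules with bases indexed by the same
    -- finite set, hence injective.
    have hsurj : Function.Surjective (KaehlerDifferential.mapBaseChange k T₀ A₁) := fun x =>
      (KaehlerDifferential.exact_mapBaseChange_map k T₀ A₁ x).mp (Subsingleton.elim _ _)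
    have : Module.Finite A₁ (A₁ ⊗[T₀] Ω[T₀⁄k]) := .of_basis b₁
    have h := OrzechProperty.injective_of_surjective_endomorphism
      (eqv.symm.toLinearMap ∘ₗ KaehlerDifferential.mapBaseChange k T₀ A₁)
      (eqv.symm.surjective.comp hsurj)
    rw [LinearMap.coe_comp] at h
    exact Function.Injective.of_comp h
  have hsm : Algebra.FormallySmooth T₀ A₁ := by
    refine ⟨inferInstance, ⟨fun x y => ?_⟩⟩
    -- Jacobi–Zariski sequence H₁(A₁/k) → H₁(A₁/T₀) → A₁ ⊗ Ω[T₀⁄k] → Ω[A₁⁄k]: the first term is zero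
    -- because A₁ is smooth over k, and the last arrow is injective.
    have h3 : ∀ x : Algebra.H1Cotangent T₀ A₁, x = 0 := fun x => by
      have h4 : Algebra.H1Cotangent.δ k T₀ A₁ x = 0 := by
        apply hinj
        rw [map_zero]
        exact (Algebra.H1Cotangent.exact_δ_mapBaseChange k T₀ A₁ _).mpr ⟨x, rfl⟩
      obtain ⟨w, rfl⟩ := (Algebra.H1Cotangent.exact_map_δ k T₀ A₁ x).mp h4
      rw [Subsingleton.elim w 0, map_zero]
    rw [h3 x, h3 y]
  exact { formallyEtale := .of_formallyUnramified_and_formallySmooth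
          finitePresentation := Algebra.FinitePresentation.of_finiteType.mp hft }

/-- Unramifiedness of a localization of a polynomial ring is tested on the variables. -/
theorem formallyUnramified_of_derivation {σ : Type} {k A₁ T₀ : Type u} [Field k] [CommRing A₁]
    [Algebra k A₁] [Algebra (MvPolynomial σ k) A₁] [IsScalarTower k (MvPolynomial σ k) A₁]
    [CommRing T₀] [Algebra k T₀] [Algebra T₀ A₁] [IsScalarTower k T₀ A₁]
    (d : MvPolynomial σ k) [IsLocalization.Away d A₁]
    (h : ∀ i, KaehlerDifferential.D T₀ A₁ (algebraMap (MvPolynomial σ k) A₁ (.X i)) = 0) :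
    Algebra.FormallyUnramified T₀ A₁ := by
  have h1 : ∀ f : MvPolynomial σ k,
      KaehlerDifferential.D T₀ A₁ (algebraMap (MvPolynomial σ k) A₁ f) = 0 := fun f => by
    have := MvPolynomial.derivation_ext
      (D₁ := ((KaehlerDifferential.D T₀ A₁).restrictScalars k).compAlgebraMap (MvPolynomial σ k))
      (D₂ := 0) (by simpa using h)
    exact DFunLike.congr_fun this f
  have h2 : ∀ f : A₁, KaehlerDifferential.D T₀ A₁ f = 0 := fun f => by
    obtain ⟨g, s, rfl⟩ := IsLocalization.exists_mk'_eq (Submonoid.powers d) f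
    have h3 := congrArg (KaehlerDifferential.D T₀ A₁) (IsLocalization.mk'_spec A₁ g s)
    rw [Derivation.leibniz, h1, h1, smul_zero, zero_add] at h3
    exact (IsLocalization.map_units A₁ s).smul_eq_zero.mp h3
  refine ⟨⟨fun x y => ?_⟩⟩
  have h4 : ∀ x : Ω[A₁⁄T₀], x = 0 := fun x => by
    have hx : x ∈ Submodule.span A₁ (Set.range (KaehlerDifferential.D T₀ A₁)) := by
      rw [KaehlerDifferential.span_range_derivation]; trivial
    have h5 : Set.range (KaehlerDifferential.D T₀ A₁) ⊆ {0} := by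
      rintro _ ⟨f, rfl⟩; exact h2 f
    simpa using Submodule.span_mono h5 hx
  rw [h4 x, h4 y]

open TensorProduct

/-! ### Integral closures in purely inseparable extensions after étale base change -/

section EtaleIntegralClosure

variable {p e : ℕ} [Fact p.Prime] {T₀ T A₁ L : Type*} [CommRing T₀] [CommRing T] [IsDomain T]
  [CommRing A₁] [Field L] [CharP L p] [Algebra T₀ T] [Algebra T₀ A₁]
  [Algebra.Etale T₀ A₁] [Algebra T₀ L] [Algebra A₁ L] [IsScalarTower T₀ A₁ L]

/-- If `T^q ⊆ T₀` and `A₁` is étale over `T₀`, then `Frac T ⊗ A₁ → L` is injective as soon as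
`A₁ → L` is. -/
theorem injective_lift_of_pow_mem {K : Type*} [Field K] [Algebra T K] [IsFractionRing T K]
    [Algebra T₀ K] [IsScalarTower T₀ T K] [Algebra K L] [IsScalarTower T₀ K L]
    (hpow : ∀ t : T, ∃ s : T₀, algebraMap T₀ T s = t ^ p ^ e)
    (hT₀ : Function.Injective (algebraMap T₀ T))
    (hA : Function.Injective (algebraMap A₁ L)) :
    Function.Injective (Algebra.TensorProduct.lift (Algebra.ofId K L)
      (IsScalarTower.toAlgHom T₀ A₁ L) fun _ _ => .all _ _) := by
  set Ψ := Algebra.TensorProduct.lift (Algebra.ofId K L)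
      (IsScalarTower.toAlgHom T₀ A₁ L) fun _ _ => .all _ _
  have hT₀K : Function.Injective (algebraMap T₀ K) := by
    rw [IsScalarTower.algebraMap_eq T₀ T K]
    exact (IsFractionRing.injective T K).comp hT₀
  have hK : CharP K p := RingHom.charP (algebraMap K L) (algebraMap K L).injective p
  have hadd : ∀ z w : K ⊗[T₀] A₁, (z + w) ^ p ^ e = z ^ p ^ e + w ^ p ^ e := by
    intro z w
    cases subsingleton_or_nontrivial (K ⊗[T₀] A₁)
    · exact Subsingleton.elim _ _
    have : CharP (K ⊗[T₀] A₁) p := charP_of_injective_algebraMap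
      (algebraMap K (K ⊗[T₀] A₁)).injective p
    exact add_pow_char_pow z w p e
  -- K^q lies in Frac T₀, so up to a denominator from T₀ every q-th power comes from A₁, where the
  -- map to L is known to be injective.
  have key : ∀ z : K ⊗[T₀] A₁, ∃ s : T₀, s ≠ 0 ∧ ∃ a : A₁,
      algebraMap T₀ (K ⊗[T₀] A₁) s * z ^ p ^ e = 1 ⊗ₜ a := by
    intro z
    induction z with
    | zero => exact ⟨1, fun h => one_ne_zero (α := K) (by rw [← map_one (algebraMap T₀ K), h,
        map_zero]), 0, by
          rw [zero_pow (pow_ne_zero _ (Fact.out (p := p.Prime)).ne_zero), mul_zero, tmul_zero]⟩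
    | tmul c a =>
      obtain ⟨t, t', ht', rfl⟩ := IsFractionRing.div_surjective (A := T) c
      obtain ⟨s, hs⟩ := hpow t
      obtain ⟨s', hs'⟩ := hpow t'
      have hs0 : algebraMap T K t' ^ p ^ e ≠ 0 := by
        refine pow_ne_zero _ ?_
        simpa using nonZeroDivisors.ne_zero ht'
      have e1 : algebraMap T₀ K s = algebraMap T K t ^ p ^ e := by
        rw [IsScalarTower.algebraMap_apply T₀ T K, hs, map_pow]
      have e2 : algebraMap T₀ K s' = algebraMap T K t' ^ p ^ e := by
        rw [IsScalarTower.algebraMap_apply T₀ T K, hs', map_pow]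
      refine ⟨s', fun h => hs0 (by rw [← e2, h, map_zero]), s • a ^ p ^ e, ?_⟩
      rw [← Algebra.smul_def, Algebra.TensorProduct.tmul_pow, smul_tmul', div_pow, ← e1, ← e2,
        Algebra.smul_def, mul_div_cancel₀ _ (e2 ▸ hs0), ← smul_tmul, Algebra.smul_def, mul_one]
    | add z w hz hw =>
      obtain ⟨s, hs, a, h⟩ := hz
      obtain ⟨s', hs', a', h'⟩ := hw
      refine ⟨s * s', ?_, s' • a + s • a', ?_⟩
      · intro h0
        have : algebraMap T₀ K s * algebraMap T₀ K s' = 0 := by rw [← map_mul, h0, map_zero]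
        rcases mul_eq_zero.mp this with h | h
        · exact hs (hT₀K (by rw [h, map_zero]))
        · exact hs' (hT₀K (by rw [h, map_zero]))
      · rw [hadd, tmul_add, tmul_smul, tmul_smul, ← h, ← h', map_mul, Algebra.smul_def,
          Algebra.smul_def]
        ring
  -- K ⊗ A₁ is étale over the field K, hence reduced. It is therefore enough to show z^q = 0 for z
  -- in the kernel.
  have hred : IsReduced (K ⊗[T₀] A₁) := Algebra.FormallyUnramified.isReduced_of_field K _
  rw [injective_iff_map_eq_zero]
  intro z hz
  obtain ⟨s, hs, a, h⟩ := key z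
  have h1 : algebraMap A₁ L a = 0 := by
    have := congrArg Ψ h
    rw [map_mul, map_pow, hz, zero_pow (pow_ne_zero _ (Fact.out (p := p.Prime)).ne_zero),
      mul_zero] at this
    simpa [Ψ] using this.symm
  rw [hA (h1.trans (map_zero _).symm), tmul_zero, ← Algebra.smul_def, algebra_compatible_smul K,
    smul_eq_zero_iff_right (fun h => hs (hT₀K (h.trans (map_zero _).symm)))] at h
  exact eq_zero_of_pow_eq_zero h

/-- Let `T` be a normal domain with `T^q ⊆ T₀` and let `A₁` be étale over `T₀`. If `L` is a field
generated by `A₁` and `T`, then the integral closure of `A₁` in `L` is étale over `T`. -/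
theorem etale_integralClosure [IsIntegrallyClosed T] [Algebra T L] [IsScalarTower T₀ T L]
    (hpow : ∀ t : T, ∃ s : T₀, algebraMap T₀ T s = t ^ p ^ e)
    (hT₀ : Function.Injective (algebraMap T₀ L))
    (hA : Function.Injective (algebraMap A₁ L))
    (hgen : ∀ F : Subfield L, (∀ a, algebraMap A₁ L a ∈ F) → (∀ t, algebraMap T L t ∈ F) →
      F = ⊤) :
    ∃ φ : T →+* integralClosure A₁ L, φ.Etale ∧ ∀ t, (φ t : L) = algebraMap T L t := by
  have hq0 : p ^ e ≠ 0 := pow_ne_zero _ (Fact.out (p := p.Prime)).ne_zero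
  have hT₀T : Function.Injective (algebraMap T₀ T) := by
    rw [IsScalarTower.algebraMap_eq T₀ T L, RingHom.coe_comp] at hT₀
    exact hT₀.of_comp
  have hT : Function.Injective (algebraMap T L) := by
    rw [injective_iff_map_eq_zero]
    intro t ht
    obtain ⟨s, hs⟩ := hpow t
    have h1 : algebraMap T₀ L s = 0 := by
      rw [IsScalarTower.algebraMap_apply T₀ T L, hs, map_pow, ht, zero_pow hq0]
    rw [hT₀ (h1.trans (map_zero _).symm), map_zero] at hs
    exact eq_zero_of_pow_eq_zero hs.symm
  let K := FractionRing T
  have : FaithfulSMul T L := (faithfulSMul_iff_algebraMap_injective T L).mpr hT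
  let : Algebra K L := FractionRing.liftAlgebra T L
  have : IsScalarTower T K L := FractionRing.isScalarTower_liftAlgebra T L
  have : IsScalarTower T₀ K L := .of_algebraMap_eq fun s => by
    rw [IsScalarTower.algebraMap_apply T₀ T L, IsScalarTower.algebraMap_apply T K L,
      ← IsScalarTower.algebraMap_apply T₀ T K]
  let Ψ : K ⊗[T₀] A₁ →ₐ[K] L := Algebra.TensorProduct.lift (Algebra.ofId K L)
      (IsScalarTower.toAlgHom T₀ A₁ L) fun _ _ => .all _ _
  have hΨ : Function.Injective Ψ := injective_lift_of_pow_mem hpow hT₀T hA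
  have hfin : Module.Finite K (K ⊗[T₀] A₁) := Algebra.FormallyUnramified.finite_of_free K _
  have hsurj : Function.Surjective Ψ := by
    -- The image is finite over K, hence closed under inverses. It is then a subfield containing A₁
    -- and T.
    have halg : Algebra.IsAlgebraic K Ψ.range := by
      have : Module.Finite K Ψ.range := .of_surjective Ψ.rangeRestrict.toLinearMap
        Ψ.rangeRestrict_surjective
      infer_instance
    let F : Subfield L :=
      { Ψ.range with
        neg_mem' := fun hx => Ψ.range.neg_mem hx
        inv_mem' := fun x hx => Subalgebra.inv_mem_of_algebraic Ψ.range (x := ⟨x, hx⟩)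
          ((halg.isAlgebraic ⟨x, hx⟩).algebraMap (A := L)) }
    have hF : F = ⊤ := hgen F (fun a => ⟨1 ⊗ₜ a, by simp [Ψ]⟩)
      (fun t => ⟨algebraMap T K t ⊗ₜ 1, by simp [Ψ]⟩)
    intro x
    have : x ∈ F := hF ▸ trivial
    exact this
  let Φ : A₁ ⊗[T₀] K →ₐ[A₁] L := Algebra.TensorProduct.lift (Algebra.ofId A₁ L)
      (IsScalarTower.toAlgHom T₀ K L) fun _ _ => .all _ _
  have hΦΨ : ∀ z, Φ z = Ψ (Algebra.TensorProduct.comm T₀ A₁ K z) := by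
    intro z
    induction z with
    | zero => simp
    | add z w hz hw => simp [hz, hw]
    | tmul a c => simp [Φ, Ψ, mul_comm, Algebra.ofId_apply]
  have hΦ : Function.Bijective Φ := by
    have : (Φ : A₁ ⊗[T₀] K → L) = Ψ ∘ Algebra.TensorProduct.comm T₀ A₁ K := funext hΦΨ
    rw [this]
    exact (Function.Bijective.comp ⟨hΨ, hsurj⟩ (AlgEquiv.bijective _))
  have hInt : Algebra.IsIntegral T₀ T := ⟨fun t => by
    obtain ⟨s, hs⟩ := hpow t
    refine .of_pow (n := p ^ e) (Nat.pos_of_ne_zero hq0) ?_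
    rw [← hs]
    exact isIntegral_algebraMap⟩
  have hcl : IsIntegralClosure T T₀ K := .of_isIntegrallyClosed T T₀ K
  -- T is the integral closure of T₀ in K, being normal and integral over T₀. By étale base change
  -- A₁ ⊗ T is the integral closure of A₁ in A₁ ⊗ K, and the latter is L.
  let e₀ : T ≃ₐ[T₀] integralClosure T₀ K := IsIntegralClosure.equiv T₀ T K (integralClosure T₀ K)
  let e₁ : A₁ ⊗[T₀] T ≃ₐ[A₁] A₁ ⊗[T₀] integralClosure T₀ K :=
    Algebra.TensorProduct.congr AlgEquiv.refl e₀
  let e₂ := AlgEquiv.ofBijective (TensorProduct.toIntegralClosure T₀ A₁ K)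
    TensorProduct.toIntegralClosure_bijective_of_smooth
  let e₃ := (AlgEquiv.ofBijective Φ hΦ).mapIntegralClosure
  let E : A₁ ⊗[T₀] T ≃ₐ[A₁] integralClosure A₁ L := (e₁.trans e₂).trans e₃
  let φ : T →+* integralClosure A₁ L :=
    E.toRingEquiv.toRingHom.comp (Algebra.TensorProduct.includeRight (R := T₀) (A := A₁)).toRingHom
  refine ⟨φ, ?_, fun t => ?_⟩
  · let : Algebra T (integralClosure A₁ L) := φ.toAlgebra
    have : Algebra.Etale T (integralClosure A₁ L) :=
      .of_equiv (A := T ⊗[T₀] A₁) (AlgEquiv.ofRingEquiv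
        (f := (Algebra.TensorProduct.comm T₀ T A₁).toRingEquiv.trans E.toRingEquiv) fun t => by
          simp [φ, RingHom.algebraMap_toAlgebra])
    exact this
  · have h1 : ((φ t : integralClosure A₁ L) : L) = Φ (1 ⊗ₜ (e₀ t : K)) := rfl
    have h2 : (e₀ t : K) = algebraMap T K t :=
      IsIntegralClosure.algebraMap_equiv T₀ T K (integralClosure T₀ K) t
    rw [h1, h2]
    simp [Φ, ← IsScalarTower.algebraMap_apply T K L]

end EtaleIntegralClosure

/-- The local structure of the integral closure `R` of a polynomial ring `A = k[σ]` in a field `L`.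
Let `ψ : k[σ] → A` be étale over the locus `d ≠ 0` and let `τ : k[σ] → T` be a normal domain with
`T^q ⊆ k[σ]`. If `L` is generated by `A` and `T`, then `R[1/d]` is étale over `T`. -/
theorem exists_etale_localization {σ : Type} {k L T : Type u} [Field k] [Finite σ] [Field L]
    [Algebra k L]
    {p e : ℕ} [Fact p.Prime] [CharP L p] [CommRing T] [Algebra k T] [IsDomain T]
    [IsIntegrallyClosed T]
    (θ : MvPolynomial σ k →ₐ[k] L) (hθ : Function.Injective θ)
    (R : Subalgebra k L) (hR : ∀ f, f ∈ R ↔ θ.toRingHom.IsIntegralElem f)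
    (ψ : MvPolynomial σ k →ₐ[k] MvPolynomial σ k) (τ : MvPolynomial σ k →ₐ[k] T) (χ : T →ₐ[k] L)
    (hcomm : ∀ i, χ (τ (.X i)) = θ (ψ (.X i)))
    (hpow : ∀ t : T, ∃ s, τ s = t ^ p ^ e)
    (d : MvPolynomial σ k) (hd : θ d ≠ 0)
    (hder : ∀ (M : Type u) [AddCommGroup M] [Module k M] [Module (MvPolynomial σ k) M]
      [IsScalarTower k (MvPolynomial σ k) M] (D : Derivation k (MvPolynomial σ k) M),
      (∀ x : M, d • x = 0 → x = 0) → (∀ i, D (ψ (.X i)) = 0) → ∀ i, D (.X i) = 0)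
    (hgen : ∀ F : Subfield L, (∀ c, algebraMap k L c ∈ F) → (∀ i, θ (.X i) ∈ F) →
      (∀ t, χ t ∈ F) → F = ⊤) :
    ∃ (S : Subalgebra k L) (hRS : R ≤ S) (φ : T →+* S), φ.Etale ∧ (∀ t, (φ t : L) = χ t) ∧
      ∃ r : R, (r : L) = θ d ∧
        letI := (Subalgebra.inclusion hRS).toRingHom.toAlgebra
        IsLocalization.Away r S := by
  let A := MvPolynomial σ k
  let A₁ := Localization.Away d
  let : Algebra A L := θ.toRingHom.toAlgebra
  have hAL : ∀ f : A, algebraMap A L f = θ f := fun _ => rfl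
  have : IsScalarTower k A L := .of_algebraMap_eq fun c => (θ.commutes c).symm
  let lift' : A₁ →+* L := IsLocalization.Away.lift (S := A₁) d (g := θ.toRingHom)
    (isUnit_iff_ne_zero.mpr hd)
  let : Algebra A₁ L := lift'.toAlgebra
  have : IsScalarTower A A₁ L := .of_algebraMap_eq fun f =>
    (IsLocalization.Away.lift_eq (S := A₁) d (g := θ.toRingHom)
      (isUnit_iff_ne_zero.mpr hd) f).symm
  have : IsScalarTower k A₁ L := .of_algebraMap_eq fun c => by
    rw [IsScalarTower.algebraMap_apply k A A₁, ← IsScalarTower.algebraMap_apply A A₁ L,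
      ← IsScalarTower.algebraMap_apply k A L]
  have hA' : Function.Injective (algebraMap A₁ L) := by
    rw [injective_iff_map_eq_zero]
    intro f hf
    obtain ⟨a, s, rfl⟩ := IsLocalization.exists_mk'_eq (Submonoid.powers d) f
    have h1 := congrArg (algebraMap A₁ L) (IsLocalization.mk'_spec A₁ a s)
    rw [map_mul, hf, zero_mul, ← IsScalarTower.algebraMap_apply A A₁ L, hAL] at h1
    rw [hθ (h1.symm.trans (map_zero θ).symm), IsLocalization.mk'_zero]
  have hdom : IsDomain A₁ := hA'.isDomain _
  have hEtale : ∃ φ : T →+* integralClosure A₁ L, φ.Etale ∧ ∀ t, (φ t : L) = χ t := by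
    -- `T₀` is an opaque copy of k[σ], because A₁ is an algebra over k[σ] in two ways: as a
    -- localization and through ψ.
    obtain ⟨T₀, _, _, ⟨ε⟩⟩ : ∃ (T₀ : Type u) (_ : CommRing T₀) (_ : Algebra k T₀),
        Nonempty (MvPolynomial σ k ≃ₐ[k] T₀) := ⟨MvPolynomial σ k, _, _, ⟨.refl⟩⟩
    let : Algebra T₀ A₁ := ((algebraMap A A₁).comp (ψ.comp ε.symm.toAlgHom).toRingHom).toAlgebra
    have hTA : ∀ s, algebraMap T₀ A₁ s = algebraMap A A₁ (ψ (ε.symm s)) := fun _ => rfl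
    let : Algebra T₀ T := (τ.comp ε.symm.toAlgHom).toRingHom.toAlgebra
    have hTT : ∀ s, algebraMap T₀ T s = τ (ε.symm s) := fun _ => rfl
    let : Algebra T L := χ.toRingHom.toAlgebra
    let : Algebra T₀ L := ((algebraMap A₁ L).comp (algebraMap T₀ A₁)).toAlgebra
    have : IsScalarTower T₀ A₁ L := .of_algebraMap_eq fun _ => rfl
    have : IsScalarTower k T₀ A₁ := .of_algebraMap_eq fun c => by
      rw [hTA, ε.symm.commutes, ψ.commutes, ← IsScalarTower.algebraMap_apply k A A₁]
    have hcomm' : ∀ s, χ (τ s) = θ (ψ s) := fun s =>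
      DFunLike.congr_fun (MvPolynomial.algHom_ext (f := χ.comp τ) (g := θ.comp ψ) hcomm) s
    have : IsScalarTower T₀ T L := .of_algebraMap_eq fun s => by
      rw [hTT, IsScalarTower.algebraMap_apply T₀ A₁ L, hTA,
        ← IsScalarTower.algebraMap_apply A A₁ L, hAL]
      exact (hcomm' _).symm
    have hunr : Algebra.FormallyUnramified T₀ A₁ := by
      refine formallyUnramified_of_derivation d fun i => ?_
      let D := ((KaehlerDifferential.D T₀ A₁).restrictScalars k).compAlgebraMap A
      refine hder _ D (fun x hx => ?_) (fun j => ?_) i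
      · rw [← algebraMap_smul A₁] at hx
        exact (IsLocalization.Away.algebraMap_isUnit (S := A₁) d).smul_eq_zero.mp hx
      · change KaehlerDifferential.D T₀ A₁ (algebraMap A A₁ (ψ (.X j))) = 0
        have h1 := hTA (ε (.X j))
        rw [ε.symm_apply_apply] at h1
        rw [← h1, Derivation.map_algebraMap]
    have het : Algebra.Etale T₀ A₁ := etale_of_formallyUnramified ε d
    have hT₀dom : IsDomain T₀ := ε.symm.injective.isDomain ε.symm.toRingHom
    have hT₀ : Function.Injective (algebraMap T₀ L) := by
      rw [IsScalarTower.algebraMap_eq T₀ A₁ L, RingHom.coe_comp]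
      exact hA'.comp (FaithfulSMul.algebraMap_injective T₀ A₁)
    refine etale_integralClosure (p := p) (e := e) (T₀ := T₀) (fun t => ?_) hT₀ hA' fun F h1 h2 =>
      hgen F (fun c => ?_) (fun i => ?_) h2
    · obtain ⟨s, hs⟩ := hpow t
      exact ⟨ε s, by rw [hTT, ε.symm_apply_apply, hs]⟩
    · rw [IsScalarTower.algebraMap_apply k A₁ L]; exact h1 _
    · rw [← hAL, IsScalarTower.algebraMap_apply A A₁ L]; exact h1 _
  obtain ⟨φ, hφ, hφχ⟩ := hEtale
  let S : Subalgebra k L := (integralClosure A₁ L).restrictScalars k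
  have hRi : ∀ f, f ∈ R ↔ IsIntegral A f := hR
  have hRS : R ≤ S := fun f hf => ((hRi f).mp hf).tower_top
  refine ⟨S, hRS, φ, hφ, hφχ, ⟨θ d, (hRi _).mpr (isIntegral_algebraMap (R := A) (A := L))⟩, rfl, ?_⟩
  let := (Subalgebra.inclusion hRS).toRingHom.toAlgebra
  have hRSL : ∀ r : R, ((algebraMap R S r : S) : L) = r := fun _ => rfl
  refine ⟨?_, ?_, ?_⟩
  · rintro ⟨_, n, rfl⟩
    rw [map_pow]
    refine IsUnit.pow _ ?_
    refine IsUnit.of_mul_eq_one ⟨algebraMap A₁ L (IsLocalization.Away.invSelf d),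
      isIntegral_algebraMap⟩ (Subtype.ext ?_)
    change algebraMap A L d * algebraMap A₁ L _ = 1
    rw [IsScalarTower.algebraMap_apply A A₁ L, ← map_mul, IsLocalization.Away.mul_invSelf, map_one]
  · intro s
    have hs : IsIntegral A₁ (s : L) := s.2
    obtain ⟨⟨_, n, rfl⟩, hm⟩ := hs.exists_multiple_integral_of_isLocalization (Submonoid.powers d) _
    refine ⟨⟨⟨_, (hRi _).mpr hm⟩, ⟨_, n, rfl⟩⟩, Subtype.ext ?_⟩
    change (s : L) * θ d ^ n = d ^ n • (s : L)
    rw [Algebra.smul_def, hAL, map_pow, mul_comm]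
  · intro x y hxy
    exact ⟨1, by rw [Subalgebra.inclusion_injective hRS hxy]⟩

/-! ### The coordinate ring of a toric quotient singularity -/

/-- A direct summand of a normal domain is normal. -/
theorem isIntegrallyClosed_of_retraction {R S : Type*} [CommRing R] [CommRing S] [IsDomain R]
    [IsDomain S] [IsIntegrallyClosed S] (ι : R →+* S) (hι : Function.Injective ι) (π : S →+ R)
    (hπ : ∀ r s, π (ι r * s) = r * π s) (hπ1 : π 1 = 1) : IsIntegrallyClosed R := by
  let : Algebra R S := ι.toAlgebra
  have : FaithfulSMul R S := (faithfulSMul_iff_algebraMap_injective R S).mpr hι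
  let : Algebra (FractionRing R) (FractionRing S) :=
    FractionRing.liftAlgebra R (FractionRing S)
  have : IsScalarTower R (FractionRing R) (FractionRing S) :=
    FractionRing.isScalarTower_liftAlgebra R (FractionRing S)
  rw [isIntegrallyClosed_iff (FractionRing R)]
  intro x hx
  obtain ⟨a, b, hb, rfl⟩ := IsFractionRing.div_surjective (A := R) x
  have hb0 : b ≠ 0 := nonZeroDivisors.ne_zero hb
  -- The fraction a/b is also integral over S, so a = b c with c in S. Applying π gives a = b π(c),
  -- hence a/b = π(c).
  have hx' := ((hx.map (IsScalarTower.toAlgHom R (FractionRing R) (FractionRing S))).tower_top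
    (A := S))
  obtain ⟨c, hc⟩ := IsIntegrallyClosed.isIntegral_iff.mp hx'
  have hb1 : algebraMap R (FractionRing S) b ≠ 0 := by
    rw [IsScalarTower.algebraMap_apply R S]
    rw [Ne, FaithfulSMul.algebraMap_eq_zero_iff, FaithfulSMul.algebraMap_eq_zero_iff]
    exact hb0
  have h1 : ι a = ι b * c := by
    apply IsFractionRing.injective S (FractionRing S)
    rw [map_mul, hc]
    simp only [IsScalarTower.coe_toAlgHom', map_div₀, ← IsScalarTower.algebraMap_apply]
    change algebraMap S _ (algebraMap R S a) = algebraMap S _ (algebraMap R S b) * _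
    rw [← IsScalarTower.algebraMap_apply R S, ← IsScalarTower.algebraMap_apply R S,
      mul_div_cancel₀ _ hb1]
  have h2 := congrArg π h1
  rw [hπ, ← mul_one (ι a), hπ, hπ1, mul_one] at h2
  refine ⟨π c, ?_⟩
  rw [h2, map_mul, mul_div_cancel_left₀]
  simpa using hb0

section Toric

variable {n : ℕ} {q : ℕ} {a : Fin n → ℤ}

/-- The points of the dual semigroup are the vectors `w` of natural numbers with
`∑ aᵢ wᵢ ≡ 0 mod q`. -/
theorem mem_dualSemigroup_iff (hq : q ≠ 0) (w : Fin n → ℝ) :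
    w ∈ dualSemigroup (quotLattice q a) (orthant n) ↔
      ∃ c : Fin n →₀ ℕ, (∀ i, w i = c i) ∧ (q : ℤ) ∣ ∑ i, a i * c i := by
  have hq' : (q : ℝ) ≠ 0 := Nat.cast_ne_zero.mpr hq
  have hsum : ∀ c : Fin n →₀ ℕ, (∀ i, w i = c i) →
      w ⬝ᵥ (fun i => (a i : ℝ) / (q : ℝ)) = ((∑ i, a i * c i : ℤ) : ℝ) / q := fun c hc => by
    rw [dotProduct, Int.cast_sum, Finset.sum_div]
    refine Finset.sum_congr rfl fun i _ => ?_
    rw [hc i]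
    push_cast
    ring
  constructor
  · rintro ⟨h1, h2⟩
    have h3 : ∀ i, ∃ c : ℕ, w i = c := fun i => by
      have hmem : (Pi.single i 1 : Fin n → ℝ) ∈ quotLattice q a :=
        (le_sup_left : _ ≤ quotLattice q a) (AddSubgroup.subset_closure ⟨i, rfl⟩)
      have hmem' : (Pi.single i 1 : Fin n → ℝ) ∈ orthant n := Submodule.subset_span ⟨i, rfl⟩
      obtain ⟨c, hc⟩ := h1 _ hmem
      have h0 := h2 _ hmem'
      rw [dotProduct_single_one] at hc h0
      rw [hc] at h0
      lift c to ℕ using by exact_mod_cast h0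
      exact ⟨c, by simpa using hc⟩
    choose c hc using h3
    refine ⟨Finsupp.equivFunOnFinite.symm c, hc, ?_⟩
    obtain ⟨z, hz⟩ := h1 _ ((le_sup_right : _ ≤ quotLattice q a)
      (AddSubgroup.mem_zmultiples _))
    rw [hsum (Finsupp.equivFunOnFinite.symm c) hc, div_eq_iff hq'] at hz
    exact ⟨z, by rw [mul_comm]; exact_mod_cast hz⟩
  · rintro ⟨c, hc, z, hz⟩
    refine ⟨fun v hv => ?_, fun v hv => ?_⟩
    · let P : AddSubgroup (Fin n → ℝ) :=
        { carrier := {v | ∃ z : ℤ, w ⬝ᵥ v = z}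
          zero_mem' := ⟨0, by simp⟩
          add_mem' := by
            rintro v v' ⟨z, hz⟩ ⟨z', hz'⟩
            exact ⟨z + z', by rw [dotProduct_add, hz, hz']; push_cast; rfl⟩
          neg_mem' := by
            rintro v ⟨z, hz⟩
            exact ⟨-z, by rw [dotProduct_neg, hz]; push_cast; rfl⟩ }
      have hP : quotLattice q a ≤ P := by
        refine sup_le ((AddSubgroup.closure_le _).mpr ?_) (AddSubgroup.zmultiples_le_of_mem ?_)
        · rintro _ ⟨i, rfl⟩
          exact ⟨c i, by rw [dotProduct_single_one, hc i]; simp⟩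
        · refine ⟨z, ?_⟩
          rw [hsum c hc, hz, div_eq_iff hq']
          push_cast
          ring
      exact hP hv
    · induction hv using Submodule.span_induction with
      | mem v hv =>
        obtain ⟨i, rfl⟩ := hv
        rw [dotProduct_single_one, hc i]
        positivity
      | zero => simp
      | add v v' _ _ h h' => rw [dotProduct_add]; exact add_nonneg h h'
      | smul r v _ h =>
        have : w ⬝ᵥ (r • v) = (r : ℝ) * (w ⬝ᵥ v) := dotProduct_smul (r : ℝ) w v
        rw [this]
        exact mul_nonneg r.2 h

variable (q a) in
/-- The semigroup of the toric variety `𝔸ⁿ / (1/q)(a₁, …, aₙ)`. -/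
abbrev Semigroup : AddSubmonoid (Fin n → ℝ) := dualSemigroup (quotLattice q a) (orthant n)

variable [NeZero q]

/-- The exponent vector of a point of the dual semigroup. -/
def exponent (s : Semigroup q a) : Fin n →₀ ℕ :=
  ((mem_dualSemigroup_iff (NeZero.ne q) s.1).mp s.2).choose

theorem exponent_spec (s : Semigroup q a) (i : Fin n) : s.1 i = exponent s i :=
  ((mem_dualSemigroup_iff (NeZero.ne q) s.1).mp s.2).choose_spec.1 i

theorem dvd_exponent (s : Semigroup q a) : (q : ℤ) ∣ ∑ i, a i * exponent s i :=
  ((mem_dualSemigroup_iff (NeZero.ne q) s.1).mp s.2).choose_spec.2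

theorem exponent_eq_iff (s : Semigroup q a) (c : Fin n →₀ ℕ) :
    exponent s = c ↔ ∀ i, s.1 i = c i := by
  refine ⟨fun h i => h ▸ exponent_spec s i, fun h => Finsupp.ext fun i => ?_⟩
  have := (exponent_spec s i).symm.trans (h i)
  exact_mod_cast this

theorem exponent_zero : exponent (0 : Semigroup q a) = 0 :=
  (exponent_eq_iff _ _).mpr fun i => by simp

theorem exponent_add (s s' : Semigroup q a) : exponent (s + s') = exponent s + exponent s' :=
  (exponent_eq_iff _ _).mpr fun i => by
    rw [AddSubmonoid.coe_add, Pi.add_apply, exponent_spec, exponent_spec]; simp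

theorem exponent_injective : Function.Injective (exponent (q := q) (a := a)) := fun s s' h =>
  Subtype.ext (funext fun i => by rw [exponent_spec, exponent_spec, h])

theorem exists_exponent_eq (c : Fin n →₀ ℕ) (hc : (q : ℤ) ∣ ∑ i, a i * c i) :
    ∃ s : Semigroup q a, exponent s = c :=
  ⟨⟨fun i => c i, (mem_dualSemigroup_iff (NeZero.ne q) _).mpr ⟨c, fun _ => rfl, hc⟩⟩,
    (exponent_eq_iff _ _).mpr fun _ => rfl⟩

variable (q a) in
/-- `exponent` as a homomorphism. -/
def exponentHom : Semigroup q a →+ (Fin n →₀ ℕ) where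
  toFun := exponent
  map_zero' := exponent_zero
  map_add' := exponent_add

variable (k : Type u) [Field k]

variable (q a) in
/-- The inclusion of the coordinate ring of `𝔸ⁿ / (1/q)(a₁, …, aₙ)` into that of `𝔸ⁿ`. -/
def quotRingInclusion : QuotRing k q a →ₐ[k] MvPolynomial (Fin n) k :=
  AddMonoidAlgebra.mapDomainAlgHom k k (exponentHom q a)

theorem quotRingInclusion_injective : Function.Injective (quotRingInclusion q a k) :=
  AddMonoidAlgebra.mapDomain_injective exponent_injective

instance isDomain_quotRing : IsDomain (QuotRing k q a) :=
  (quotRingInclusion_injective k).isDomain (quotRingInclusion q a k).toRingHom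

variable (q a) in
/-- The projection of `k[x₁, …, xₙ]` onto the span of the monomials in the dual semigroup. -/
def quotRingRetraction : MvPolynomial (Fin n) k →+ QuotRing k q a where
  toFun f := .ofCoeff
    ((AddMonoidAlgebra.coeff f).comapDomain exponent exponent_injective.injOn)
  map_zero' := by ext; simp
  map_add' f g := by ext; simp

theorem quotRingRetraction_single (s : Semigroup q a) (c : k) :
    quotRingRetraction q a k (AddMonoidAlgebra.single (exponent s) c) =
      AddMonoidAlgebra.single s c := by
  classical
  ext s'
  simp [quotRingRetraction, Finsupp.single_apply]

theorem quotRingRetraction_single_of_notMem (w : Fin n →₀ ℕ) (c : k)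
    (hw : ∀ s : Semigroup q a, exponent s ≠ w) :
    quotRingRetraction q a k (AddMonoidAlgebra.single w c) = 0 := by
  classical
  ext s'
  simp [quotRingRetraction, (hw s').symm]

theorem quotRingInclusion_single (s : Semigroup q a) (c : k) :
    quotRingInclusion q a k (AddMonoidAlgebra.single s c) =
      AddMonoidAlgebra.single (exponent s) c :=
  AddMonoidAlgebra.mapDomain_single

/-- Adding an exponent of the semigroup does not change the class of ∑ aᵢ wᵢ mod q, so the span of
the remaining monomials is a submodule. With this the toric ring is a direct summand of a polynomial
ring, hence normal. -/
theorem quotRingRetraction_mul (r : QuotRing k q a) (f : MvPolynomial (Fin n) k) :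
    quotRingRetraction q a k (quotRingInclusion q a k r * f) = r * quotRingRetraction q a k f := by
  induction r using AddMonoidAlgebra.induction_linear with
  | zero => simp
  | add r r' h h' => rw [map_add, add_mul, map_add, h, h', add_mul]
  | single s b =>
    induction f using AddMonoidAlgebra.induction_linear with
    | zero => simp
    | add f g h h' => rw [mul_add, map_add, h, h', map_add, mul_add]
    | single w c =>
      rw [quotRingInclusion_single]
      have hmul : (AddMonoidAlgebra.single (exponent s) b * AddMonoidAlgebra.single w c :
          MvPolynomial (Fin n) k) = AddMonoidAlgebra.single (exponent s + w) (b * c) :=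
        AddMonoidAlgebra.single_mul_single ..
      by_cases hw : ∃ s' : Semigroup q a, exponent s' = w
      · obtain ⟨s', rfl⟩ := hw
        rw [hmul, ← exponent_add, quotRingRetraction_single, quotRingRetraction_single,
          AddMonoidAlgebra.single_mul_single]
      · rw [hmul, quotRingRetraction_single_of_notMem, quotRingRetraction_single_of_notMem,
          mul_zero]
        · exact fun s' h => hw ⟨s', h⟩
        · intro s' h
          refine hw (exists_exponent_eq w ?_)
          have h1 := dvd_exponent s'
          simp only [h, Finsupp.add_apply, Nat.cast_add, mul_add, Finset.sum_add_distrib] at h1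
          exact (dvd_add_right (dvd_exponent s)).mp h1

instance isIntegrallyClosed_quotRing : IsIntegrallyClosed (QuotRing k q a) :=
  isIntegrallyClosed_of_retraction (quotRingInclusion q a k).toRingHom
    (quotRingInclusion_injective k) (quotRingRetraction q a k) (quotRingRetraction_mul k) (by
      have h := quotRingRetraction_single (q := q) (a := a) k 0 1
      rw [exponent_zero] at h
      exact h)

theorem exists_exponent_eq_single (i : Fin n) : ∃ s : Semigroup q a, exponent s = .single i q :=
  exists_exponent_eq _ (by
    classical
    simp [Finsupp.single_apply])

variable (q a) in
/-- The monomial `xᵢ^q`. -/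
def basePoint (i : Fin n) : Semigroup q a := (exists_exponent_eq_single i).choose

theorem exponent_basePoint (i : Fin n) : exponent (basePoint q a i) = .single i q :=
  (exists_exponent_eq_single i).choose_spec

variable (q a) in
/-- The inclusion of `k[u^q, x₁^q, …, xₙ^q]` into `k[σ^∨ ∩ M][u]`. -/
def basePowers : MvPolynomial (Option (Fin n)) k →ₐ[k] Polynomial (QuotRing k q a) :=
  MvPolynomial.aeval fun i => i.elim (Polynomial.X ^ q)
    fun i => Polynomial.C (AddMonoidAlgebra.single (basePoint q a i) 1)

theorem nsmul_eq_sum_basePoint (s : Semigroup q a) :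
    q • s = ∑ i, exponent s i • basePoint q a i := by
  apply exponent_injective
  change exponentHom q a _ = exponentHom q a _
  rw [map_nsmul, map_sum]
  simp only [map_nsmul]
  change q • exponent s = ∑ i, exponent s i • exponent (basePoint q a i)
  simp only [exponent_basePoint]
  ext j
  classical
  simp [Finsupp.finsetSum_apply, Finsupp.single_apply, mul_comm]

theorem single_nsmul_eq (s : Semigroup q a) :
    (Polynomial.C (AddMonoidAlgebra.single (q • s) 1) : Polynomial (QuotRing k q a)) =
      ∏ i, basePowers q a k (.X (some i)) ^ exponent s i := by
  rw [nsmul_eq_sum_basePoint]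
  simp only [basePowers, MvPolynomial.aeval_X, Option.elim_some, ← map_pow, ← map_prod,
    AddMonoidAlgebra.single_pow, one_pow]
  congr 1
  simp

theorem exists_basePowers_eq_pow (p e : ℕ) [Fact p.Prime] [CharP k p]
    [NeZero (p ^ e)] (t : Polynomial (QuotRing k (p ^ e) a)) :
    ∃ s, basePowers (p ^ e) a k s = t ^ p ^ e := by
  have : CharP (Polynomial (QuotRing k (p ^ e) a)) p := charP_of_injective_algebraMap
    (algebraMap k (Polynomial (QuotRing k (p ^ e) a))).injective p
  -- The elements whose q-th power lies in the image form a subring, by Frobenius, so it suffices to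
  -- treat u, the scalars and the monomials.
  let P : Subring (Polynomial (QuotRing k (p ^ e) a)) :=
    (basePowers (p ^ e) a k).toRingHom.range.comap (iterateFrobenius _ p e)
  have hP : ∀ t, t ∈ P ↔ ∃ s, basePowers (p ^ e) a k s = t ^ p ^ e := fun t => Iff.rfl
  rw [← hP]
  have hX : (Polynomial.X : Polynomial (QuotRing k (p ^ e) a)) ∈ P :=
    (hP _).mpr ⟨.X none, by simp [basePowers]⟩
  have hk : ∀ c : k, Polynomial.C (algebraMap k (QuotRing k (p ^ e) a) c) ∈ P := fun c =>
    (hP _).mpr ⟨.C (c ^ p ^ e), by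
      rw [← MvPolynomial.algebraMap_eq, AlgHom.commutes, ← map_pow, ← map_pow]; rfl⟩
  have hC : ∀ r : QuotRing k (p ^ e) a, Polynomial.C r ∈ P := fun r => by
    induction r using AddMonoidAlgebra.induction_linear with
    | zero => rw [map_zero]; exact P.zero_mem
    | add r r' h h' => rw [map_add]; exact P.add_mem h h'
    | single s c =>
      have h1 : AddMonoidAlgebra.single s c =
          algebraMap k (QuotRing k (p ^ e) a) c * AddMonoidAlgebra.single s 1 := by
        rw [← Algebra.smul_def, AddMonoidAlgebra.smul_single, smul_eq_mul, mul_one]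
      rw [h1, map_mul]
      refine P.mul_mem (hk c) ((hP _).mpr
        ⟨∏ i, (.X (some i)) ^ exponent s i, ?_⟩)
      rw [map_prod, ← map_pow, AddMonoidAlgebra.single_pow, one_pow, single_nsmul_eq]
      simp only [map_pow]
  induction t using Polynomial.induction_on' with
  | add t t' h h' => exact P.add_mem h h'
  | monomial i r =>
    rw [← Polynomial.C_mul_X_pow_eq_monomial]
    exact P.mul_mem (hC r) (P.pow_mem hX i)

/-- A prime over the origin of `Spec k[x₁^q, …, xₙ^q]` lies on the line over the vertex. -/
theorem mem_vertexLine (z : QuotTimesLine k q a)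
    (hz : ∀ i, basePowers q a k (.X (some i)) ∈ PrimeSpectrum.asIdeal z) :
    z ∈ vertexLine k q a := by
  refine (PrimeSpectrum.mem_zeroLocus z _).mpr ?_
  rintro _ ⟨s, hs, rfl⟩
  have hex : ∃ i, exponent s i ≠ 0 := by
    by_contra! h
    exact hs (exponent_injective (by rw [exponent_zero]; exact Finsupp.ext h))
  obtain ⟨i, hi⟩ := hex
  -- The q-th power of the character s is a monomial in the xⱼ^q in which xᵢ^q occurs.
  refine (PrimeSpectrum.isPrime z).mem_of_pow_mem q ?_
  rw [← map_pow, AddMonoidAlgebra.single_pow, one_pow, single_nsmul_eq]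
  exact Ideal.mem_of_dvd _ (Finset.dvd_prod_of_mem _ (Finset.mem_univ i))
    (Ideal.pow_mem_of_mem _ (hz i) _ (Nat.pos_of_ne_zero hi))

variable {L : Type u} [Field L] [Algebra k L]

/-- The character with values in a field `L` of the dual semigroup that maps `eᵢ - aᵢ e` to `gᵢ`
and `q e` to `ξ`, where `e` is a unit vector. -/
def character (ξ : L) (hξ : ξ ≠ 0) (g : Fin n → L) : Multiplicative (Semigroup q a) →* L where
  toFun s := ξ ^ ((∑ i, a i * exponent s.toAdd i) / q) * ∏ i, g i ^ exponent s.toAdd i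
  map_one' := by
    rw [toAdd_one, exponent_zero]
    simp
  map_mul' s s' := by
    rw [toAdd_mul, exponent_add]
    simp only [Finsupp.add_apply, Nat.cast_add, mul_add, Finset.sum_add_distrib, pow_add,
      Finset.prod_mul_distrib]
    -- On the semigroup the division by q is exact, hence additive.
    rw [Int.add_ediv_of_dvd_left (dvd_exponent _), zpow_add₀ hξ]
    ring

/-- The homomorphism `k[σ^∨ ∩ M][u] → L` given by a character and the image of `u`. -/
def toricHom (ξ : L) (hξ : ξ ≠ 0) (g : Fin n → L) (u : L) :
    Polynomial (QuotRing k q a) →ₐ[k] L :=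
  Polynomial.eval₂AlgHom (AddMonoidAlgebra.lift k L _ (character ξ hξ g)) u fun _ => .all _ _

theorem toricHom_basePowers_none (ξ : L) (hξ : ξ ≠ 0) (g : Fin n → L) (u : L) :
    toricHom (q := q) (a := a) k ξ hξ g u (basePowers q a k (.X none)) = u ^ q := by
  simp [toricHom, basePowers]

theorem toricHom_basePowers_some (ξ : L) (hξ : ξ ≠ 0) (g : Fin n → L) (u : L) (i : Fin n) :
    toricHom (q := q) (a := a) k ξ hξ g u (basePowers q a k (.X (some i))) =
      ξ ^ a i * g i ^ q := by
  classical
  simp [toricHom, basePowers, character, exponent_basePoint, Finsupp.single_apply, pow_ite,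
    NeZero.ne q]

theorem toricHom_X (ξ : L) (hξ : ξ ≠ 0) (g : Fin n → L) (u : L) :
    toricHom (q := q) (a := a) k ξ hξ g u .X = u := by
  simp [toricHom]

/-- The vector eᵢ need not lie in the semigroup, but eᵢ + r e₀ does for r = -aᵢ mod q, because a₀ =
1. Since g₀ = 1, the extra summand only contributes a power of ξ. This recovers gᵢ when checking
that the toric ring generates the field. -/
theorem exists_toricHom_eq [NeZero n] (ha : a 0 = 1) (ξ : L) (hξ : ξ ≠ 0) (g : Fin n → L)
    (hg : g 0 = 1) (u : L) (i : Fin n) :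
    ∃ (t : Polynomial (QuotRing k q a)) (z : ℤ), toricHom k ξ hξ g u t = ξ ^ z * g i := by
  classical
  have hr : 0 ≤ (-a i) % q := Int.emod_nonneg _ (by exact_mod_cast NeZero.ne q)
  obtain ⟨s, hs⟩ := exists_exponent_eq (q := q) (a := a)
    (.single i 1 + .single 0 ((-a i) % q).toNat) (by
      simp only [Finsupp.add_apply, Finsupp.single_apply, Nat.cast_add, mul_add,
        Finset.sum_add_distrib]
      simp [ha, Int.toNat_of_nonneg hr, Int.dvd_iff_emod_eq_zero])
  refine ⟨.C (AddMonoidAlgebra.single s 1), (∑ j, a j * exponent s j) / q, ?_⟩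
  have h1 : ∏ j, g j ^ exponent s j = g i := by
    simp only [hs, Finsupp.add_apply, Finsupp.single_apply, pow_add, Finset.prod_mul_distrib]
    simp [pow_ite, hg]
  simp only [toricHom, Polynomial.eval₂AlgHom_apply, Polynomial.eval₂_C, RingHom.coe_coe,
    AddMonoidAlgebra.lift_single, one_smul]
  exact congrArg _ h1

end Toric

/-! ### Affine charts of the normalisation -/

/-- Let `f : Spec L ⟶ P` factor through an affine open subscheme `Spec A` of `P`. Over `Spec A`, the
normalisation of `P` in `Spec L` is the spectrum of the integral closure of `A` in `L`. -/
theorem exists_chart_normalization {P : Scheme.{u}} {A L : CommRingCat.{u}} (j : Spec A ⟶ P)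
    [IsOpenImmersion j] (φ : A ⟶ L) (f : Spec L ⟶ P) [QuasiCompact f] [QuasiSeparated f]
    (hf : f = Spec.map φ ≫ j) (R : Subring L) (hR : ∀ x, x ∈ R ↔ φ.hom.IsIntegralElem x) :
    ∃ J : Spec (.of R) ⟶ f.normalization, IsOpenImmersion J ∧
      J ≫ f.fromNormalization = Spec.map (CommRingCat.ofHom (φ.hom.codRestrict R fun _ =>
        (hR _).mpr φ.hom.isIntegralElem_map)) ≫ j ∧
      Set.range J = f.fromNormalization ⁻¹' Set.range j := by
  have hU : IsAffineOpen j.opensRange := isAffineOpen_opensRange j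
  let U : P.affineOpens := ⟨j.opensRange, hU⟩
  have hjU : ⊤ ≤ j ⁻¹ᵁ j.opensRange := by simp
  have hfU : f ⁻¹ᵁ j.opensRange = ⊤ := by
    subst hf
    rw [Scheme.Hom.comp_preimage, top_le_iff.mp hjU]; rfl
  -- `α` identifies the functions on the affine open with A, and `β` those on its preimage, which is
  -- all of Spec L, with L. Under them the map on sections becomes φ (`hαβ`), and integral closures
  -- correspond (`hC`).
  let α : Γ(P, j.opensRange) ⟶ A := j.appLE j.opensRange ⊤ hjU ≫ (Scheme.ΓSpecIso A).hom
  let β : Γ(Spec L, f ⁻¹ᵁ j.opensRange) ⟶ L :=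
    (Spec L).presheaf.map (homOfLE hfU.ge).op ≫ (Scheme.ΓSpecIso L).hom
  have hα : IsIso α := by
    have h1 : IsIso (j.appLE j.opensRange ⊤ hjU) := by
      have h2 : IsIso (j.app j.opensRange) := j.isIso_app _ le_rfl
      have h3 : IsIso (homOfLE hjU) := ⟨homOfLE le_top, rfl, rfl⟩
      rw [Scheme.Hom.appLE]
      infer_instance
    infer_instance
  have hβ : IsIso β := by
    have : IsIso (homOfLE hfU.ge) := ⟨homOfLE hfU.le, rfl, rfl⟩
    infer_instance
  have hαβ : f.app j.opensRange ≫ β = α ≫ φ := by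
    have h1 : f.app j.opensRange ≫ (Spec L).presheaf.map (homOfLE hfU.ge).op =
        f.appLE j.opensRange ⊤ hfU.ge := rfl
    have h2 : f.appLE j.opensRange ⊤ hfU.ge =
        j.appLE j.opensRange ⊤ hjU ≫ (Spec.map φ).appTop := by
      subst hf
      rw [← Scheme.Hom.appLE_comp_appLE _ _ _ ⊤ _ hjU le_top]
      simp only [Scheme.Hom.appLE, Category.assoc]
      erw [Category.comp_id]
    simp only [β, α]
    rw [reassoc_of% h1, h2, Category.assoc, Category.assoc, Scheme.ΓSpecIso_naturality]
  let := (f.app U.1).hom.toAlgebra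
  let C := integralClosure Γ(P, U.1) Γ(Spec L, f ⁻¹ᵁ U.1)
  have hαβ' : ∀ s, β.hom (algebraMap Γ(P, U.1) Γ(Spec L, f ⁻¹ᵁ U.1) s) = φ.hom (α.hom s) :=
    fun s => ConcreteCategory.congr_hom hαβ s
  have hαβ'' : β.hom.comp (algebraMap Γ(P, U.1) Γ(Spec L, f ⁻¹ᵁ U.1)) = φ.hom.comp α.hom :=
    RingHom.ext hαβ'
  have hβbij : Function.Bijective β.hom := ConcreteCategory.bijective_of_isIso β
  have hC : ∀ x, x ∈ C ↔ β.hom x ∈ R := by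
    intro x
    rw [hR]
    constructor
    · rintro ⟨g, hg, hx⟩
      refine ⟨g.map α.hom, hg.map _, ?_⟩
      rw [Polynomial.eval₂_map, ← hαβ'', ← Polynomial.hom_eval₂]
      exact (congrArg β.hom hx).trans (map_zero _)
    · rintro ⟨g, hg, hx⟩
      refine ⟨g.map (inv α).hom, hg.map _, hβbij.1 ?_⟩
      have h1 : α.hom.comp (inv α).hom = RingHom.id A :=
        RingHom.ext fun s => ConcreteCategory.congr_hom (IsIso.inv_hom_id α) s
      rw [map_zero, Polynomial.hom_eval₂, hαβ'', ← hx, Polynomial.eval₂_map, RingHom.comp_assoc,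
        h1, RingHom.comp_id]
  let γ : C ≃+* R := RingEquiv.ofBijective
    ((β.hom.comp C.val.toRingHom).codRestrict R fun x => (hC _).mp x.2)
    ⟨fun x y h => Subtype.ext (hβbij.1 (congrArg Subtype.val h)), fun y => by
      obtain ⟨x, hx⟩ := hβbij.2 y.1
      exact ⟨⟨x, (hC x).mpr (hx ▸ y.2)⟩, Subtype.ext hx⟩⟩
  obtain ⟨c, hc1, hc2, hc3⟩ : ∃ c : Spec (CommRingCat.of C) ⟶ f.normalization,
      IsOpenImmersion c ∧ c ≫ f.fromNormalization =
        Spec.map (CommRingCat.ofHom (algebraMap Γ(P, U.1) C)) ≫ hU.fromSpec ∧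
      Set.range c = f.fromNormalization ⁻¹' Set.range j :=
    ⟨f.normalizationOpenCover.f U, f.normalizationOpenCover.map_prop U, f.ι_fromNormalization U,
      (congrArg (fun V : f.normalization.Opens => (V : Set f.normalization))
        (f.fromNormalization_preimage U)).symm⟩
  have hγ : IsIso (Spec.map γ.toCommRingCatIso.hom) := inferInstance
  refine ⟨Spec.map γ.toCommRingCatIso.hom ≫ c, inferInstance, ?_, ?_⟩
  · have h1 : hU.fromSpec = Spec.map (inv α) ≫ j := by
      rw [← cancel_epi (Spec.map α), ← Spec.map_comp_assoc, IsIso.inv_hom_id, Spec.map_id,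
        Category.id_comp]
      have := IsAffineOpen.SpecMap_appLE_fromSpec j hU (isAffineOpen_top (Spec A)) hjU
      simp only [α, Spec.map_comp, Category.assoc, this, IsAffineOpen.fromSpec_top]
      rw [Scheme.isoSpec_Spec_inv, ← Spec.map_comp_assoc, Iso.inv_hom_id, Spec.map_id,
        Category.id_comp]
    rw [Category.assoc, hc2, h1, ← Spec.map_comp_assoc, ← Spec.map_comp_assoc]
    congr 2
    rw [IsIso.inv_comp_eq]
    refine CommRingCat.hom_ext (RingHom.ext fun s => Subtype.ext (hαβ' s))
  · rw [← hc3]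
    have : Function.Surjective (Spec.map γ.toCommRingCatIso.hom) :=
      (Scheme.homeoOfIso (asIso (Spec.map γ.toCommRingCatIso.hom))).surjective
    rw [Scheme.Hom.comp_base, TopCat.coe_comp, this.range_comp]

/-- The morphism from `Spec L` to `Proj A` given by `ev : A → L` factors through `D₊(r)` if
`ev r` is invertible. -/
theorem fromOfGlobalSections_eq {σ A : Type u} [CommRing A] [SetLike σ A] [AddSubgroupClass σ A]
    (𝒜 : ℕ → σ) [GradedRing 𝒜] {L : CommRingCat.{u}} (f : A →+* Γ(Spec L, ⊤))
    (hf : (HomogeneousIdeal.irrelevant 𝒜).toIdeal.map f = ⊤) (ev : A →+* L)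
    (hev : ∀ a, (Scheme.ΓSpecIso L).hom.hom (f a) = ev a) {r : A} {d : ℕ} (hd : 0 < d)
    (hr : r ∈ 𝒜 d) (hu : IsUnit (ev r)) :
    Proj.fromOfGlobalSections 𝒜 f hf = Spec.map (CommRingCat.ofHom
      ((IsLocalization.Away.lift r hu).comp (algebraMap (HomogeneousLocalization.Away 𝒜 r)
        (Localization.Away r)))) ≫ Proj.awayι 𝒜 r hr hd := by
  have hu' : IsUnit ((Scheme.ΓSpecIso L).hom.hom (f r)) := by rwa [hev]
  have hfr : IsUnit (f r) :=
    (isUnit_map_iff (Scheme.ΓSpecIso L).commRingCatIsoToRingEquiv (f r)).mp hu'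
  have htop : (Spec L).basicOpen (f r) = ⊤ := (Spec L).basicOpen_of_isUnit hfr
  -- The preimage of D₊(r) is all of Spec L, so the two morphisms may be compared on it, where the
  -- morphism to Proj has an explicit description.
  have hiso : IsIso ((Spec L).basicOpen (f r)).ι := by
    rw [htop]; exact inferInstanceAs (IsIso (Scheme.topIso _).hom)
  rw [← cancel_epi ((Spec L).basicOpen (f r)).ι]
  have h1 := Scheme.Hom.resLE_comp_ι (Proj.fromOfGlobalSections 𝒜 f hf)
    (Proj.fromOfGlobalSections_preimage_basicOpen 𝒜 f hf hd hr).ge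
  rw [← h1, Proj.fromOfGlobalSections_resLE 𝒜 f hf hd hr]
  have hmem : Submonoid.powers r ≤ (Submonoid.powers (f r)).comap f := by
    rw [← Submonoid.map_le_iff_le_comap, Submonoid.map_powers]
  have h2 : (IsLocalization.Away.lift r hu : Localization.Away r →+* L) =
      (IsLocalization.Away.lift (S := Localization.Away (f r)) (f r) hu').comp
        (IsLocalization.map (M := .powers r) (T := .powers (f r)) _ f hmem) := by
    refine IsLocalization.ringHom_ext (.powers r) (RingHom.ext fun s => ?_)
    simp only [RingHom.comp_apply, IsLocalization.map_eq, IsLocalization.Away.lift_eq, hev]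
  have h3 : ((Spec L).basicOpen (f r)).ι ≫ Spec.map (CommRingCat.ofHom
      (IsLocalization.Away.lift (S := Localization.Away (f r)) (f r) hu')) =
      ((Spec L).isoOfEq ((Spec L).toSpecΓ_preimage_basicOpen (f r))).inv ≫
        (Spec L).toSpecΓ ∣_ _ ≫ (basicOpenIsoSpecAway _).hom := by
    have : Mono (Spec.map (CommRingCat.ofHom
      (algebraMap Γ(Spec L, ⊤) (Localization.Away (f r))))) := inferInstance
    rw [← cancel_mono (Spec.map (CommRingCat.ofHom
      (algebraMap Γ(Spec L, ⊤) (Localization.Away (f r)))))]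
    simp only [Category.assoc]
    rw [basicOpenIsoSpecAway_hom_SpecMap, ← Spec.map_comp]
    refine Eq.trans ?_ (congrArg (_ ≫ ·) (morphismRestrict_ι (Spec L).toSpecΓ
      (PrimeSpectrum.basicOpen (f r))).symm)
    rw [Scheme.isoOfEq_inv_ι_assoc, ← SpecMap_ΓSpecIso_hom]
    congr 2
    ext s
    simp
  have h4 : Proj.toBasicOpenOfGlobalSections 𝒜 f rfl hd hr =
      (((Spec L).isoOfEq ((Spec L).toSpecΓ_preimage_basicOpen (f r))).inv ≫
        (Spec L).toSpecΓ ∣_ _ ≫ (basicOpenIsoSpecAway _).hom) ≫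
        Spec.map (CommRingCat.ofHom (RingHom.comp
          (IsLocalization.map (M := .powers r) (T := .powers (f r)) _ f hmem)
          (algebraMap _ (Localization.Away r)))) ≫ (Proj.basicOpenIsoSpec 𝒜 r hr hd).inv := by
    simp only [Category.assoc]
    rfl
  rw [h4, ← h3, h2, RingHom.comp_assoc, CommRingCat.ofHom_comp (f := RingHom.comp _ _)]
  simp only [Category.assoc, Proj.basicOpenIsoSpec_inv_ι, Spec.map_comp]

/-! ### The standard charts of `𝒴` -/

/-- Integrality depends only on the image of the coefficient ring: a monic equation with
coefficients in the image of g lifts to a monic one. This allows passing between homogeneous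
localizations, polynomial rings and subalgebras of L. -/
theorem isIntegralElem_of_range_le {A B L : Type*} [CommRing A] [CommRing B] [CommRing L]
    {f : A →+* L} {g : B →+* L} (h : f.range ≤ g.range) {x : L} (hx : f.IsIntegralElem x) :
    g.IsIntegralElem x := by
  obtain ⟨P, hP, hx⟩ := hx
  have hl : P.map f ∈ Polynomial.lifts g := by
    rw [Polynomial.lifts_iff_coeffs_subset_range]
    intro c hc
    obtain ⟨i, -, rfl⟩ := Polynomial.mem_coeffs_iff.mp hc
    rw [Polynomial.coeff_map]
    exact h ⟨_, rfl⟩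
  obtain ⟨Q, hQ, -, hm⟩ := Polynomial.lifts_and_natDegree_eq_and_monic hl (hP.map f)
  exact ⟨Q, hm, by rw [Polynomial.eval₂_eq_eval_map, hQ, ← Polynomial.eval₂_eq_eval_map, hx]⟩

theorem eval₂_div_pow {R L σ : Type*} [CommRing R] [Field L] (f : R →+* L) (y : σ → L) (c : L)
    {P : MvPolynomial σ R} {d : ℕ} (hP : P.IsHomogeneous d) :
    P.eval₂ f y / c ^ d = P.eval₂ f (fun i => y i / c) := by
  rw [MvPolynomial.eval₂_eq, MvPolynomial.eval₂_eq, Finset.sum_div]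
  refine Finset.sum_congr rfl fun α hα => ?_
  have : α.degree = d := by
    rw [Finsupp.degree_eq_weight_one]
    exact hP (MvPolynomial.mem_support_iff.mp hα)
  rw [mul_div_assoc]
  simp only [div_pow, Finset.prod_div_distrib, ← this, Finsupp.degree_apply,
    Finset.prod_pow_eq_pow_sum]

/-- The functions `Yᵢ / Yⱼ` and `t` generate the coordinate ring of the `j`-th standard chart. -/
def chartRing (k : Type u) [Field k] {n : ℕ} {L : Type u} [Field L] [Algebra k L] (s : L)
    (y : Fin (n + 1) → L) (j : Fin (n + 1)) : Subalgebra k L :=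
  Algebra.adjoin k
    (insert s (Set.range fun i => y i / y j))

/-- The degree 0 fraction P / Xⱼ^d is sent to P evaluated at the yᵢ / yⱼ, so the coordinate ring of
D₊(Xⱼ) has image `chartRing k s y j` in L. The last clause holds because Xᵢ / Xⱼ pulls back to r; it
locates the points lying outside another chart. -/
theorem exists_chart_proj (k : Type u) [Field k] {n : ℕ} {L : Type u} [Field L] [Algebra k L]
    (s : L) (y : Fin (n + 1) → L) (hy : ∀ i, y i ≠ 0)
    (g : MvPolynomial (Fin (n + 1)) (Polynomial k) →+* Γ(Spec (.of L), ⊤))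
    (hg : (HomogeneousIdeal.irrelevant (grading k n)).toIdeal.map g = ⊤)
    (hge : ∀ a, (Scheme.ΓSpecIso (.of L)).hom.hom (g a) =
      MvPolynomial.eval₂Hom (Polynomial.aeval (R := k) s).toRingHom y a)
    (f : Spec (.of L) ⟶ ProjTimesLine k n) [QuasiCompact f] [QuasiSeparated f]
    (hf : f = Proj.fromOfGlobalSections (grading k n) g hg) (j : Fin (n + 1))
    (R : Subalgebra k L)
    (hR : ∀ f, f ∈ R ↔ (algebraMap (chartRing k s y j) L).IsIntegralElem f) :
    ∃ J : Spec (.of R) ⟶ f.normalization, IsOpenImmersion J ∧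
      J ≫ f.fromNormalization ≫ projToBase k n = Spec.map (CommRingCat.ofHom (algebraMap k R)) ∧
      (∀ a, a ∈ Set.range J ↔ f.fromNormalization a ∈
        Proj.basicOpen (grading k n) (MvPolynomial.X j)) ∧
      ∀ (z : Spec (.of R)) (i : Fin (n + 1)) (r : R),
        (r : L) = y i / y j →
        (f.fromNormalization (J z) ∈
          Proj.basicOpen (grading k n) (MvPolynomial.X i) ↔ r ∉ PrimeSpectrum.asIdeal z) := by
  have hX : ∀ j, (MvPolynomial.X j : MvPolynomial (Fin (n + 1)) (Polynomial k)) ∈ grading k n 1 :=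
    fun j => MvPolynomial.isHomogeneous_X _ _
  have hu : IsUnit
      (MvPolynomial.eval₂Hom (Polynomial.aeval (R := k) s).toRingHom y (MvPolynomial.X j)) := by
    simp only [MvPolynomial.eval₂Hom_X']; exact (hy j).isUnit
  let ev : HomogeneousLocalization.Away (grading k n) (MvPolynomial.X j) →+* L :=
    (IsLocalization.Away.lift (S := Localization.Away
        (MvPolynomial.X j : MvPolynomial (Fin (n + 1)) (Polynomial k))) _ hu).comp
      (algebraMap (HomogeneousLocalization.Away (grading k n) (MvPolynomial.X j))
        (Localization.Away (MvPolynomial.X j : MvPolynomial (Fin (n + 1)) (Polynomial k))))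
  have hev : ∀ (d : ℕ) (P) (hP : P ∈ grading k n (d • 1)),
      ev (.mk (grading k n) (hX j) d P hP) =
        P.eval₂ ((Polynomial.aeval (R := k) s).toRingHom) (fun i => y i / y j) := by
    intro d P hP
    rw [← eval₂_div_pow _ _ _ hP, smul_eq_mul, mul_one,
      eq_div_iff (pow_ne_zero _ (hy j)),
      ← MvPolynomial.eval₂Hom_X' (Polynomial.aeval (R := k) s).toRingHom y j, ← map_pow]
    have h1 : P.eval₂ (Polynomial.aeval (R := k) s).toRingHom y =
        MvPolynomial.eval₂Hom (Polynomial.aeval (R := k) s).toRingHom y P := by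
      rfl
    rw [h1, RingHom.comp_apply, HomogeneousLocalization.algebraMap_apply,
      HomogeneousLocalization.Away.val_mk,
      ← IsLocalization.Away.lift_eq (S := Localization.Away
        (MvPolynomial.X j : MvPolynomial (Fin (n + 1)) (Polynomial k))) _ hu (_ ^ d), ← map_mul,
      ← Localization.mk_one_eq_algebraMap, Localization.mk_mul]
    rw [← IsLocalization.Away.lift_eq (S := Localization.Away
        (MvPolynomial.X j : MvPolynomial (Fin (n + 1)) (Polynomial k))) _ hu,
      ← Localization.mk_one_eq_algebraMap]
    congr 1
    rw [Localization.mk_eq_mk_iff, Localization.r_iff_exists]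
    exact ⟨1, by simp; ring⟩
  have hrange : ∀ a : L, a ∈ Set.range ev ↔ a ∈ chartRing k s y j := by
    intro f
    constructor
    · rintro ⟨a, rfl⟩
      obtain ⟨d, P, hP, rfl⟩ := HomogeneousLocalization.Away.mk_surjective _ (hX j) a
      rw [hev, MvPolynomial.eval₂_eq]
      refine sum_mem fun α _ => mul_mem ?_ (prod_mem fun i _ => pow_mem ?_ _)
      · exact Polynomial.aeval_mem_adjoin_singleton _ _ |> Algebra.adjoin_mono (by simp)
      · exact Algebra.subset_adjoin (Or.inr ⟨i, rfl⟩)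
    · intro hf
      induction hf using Algebra.adjoin_induction with
      | mem f hf =>
        rcases hf with rfl | ⟨i, rfl⟩
        · exact ⟨_, (hev 0 (.C .X) (MvPolynomial.isHomogeneous_C _ _)).trans (by simp)⟩
        · exact ⟨_, (hev 1 (.X i) (MvPolynomial.isHomogeneous_X _ _)).trans (by simp)⟩
      | algebraMap c =>
        exact ⟨_, (hev 0 (.C (.C c)) (MvPolynomial.isHomogeneous_C _ _)).trans (by simp)⟩
      | add _ _ _ _ h1 h2 =>
        obtain ⟨⟨a, rfl⟩, ⟨b, rfl⟩⟩ := And.intro h1 h2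
        exact ⟨a + b, map_add ev a b⟩
      | mul _ _ _ _ h1 h2 =>
        obtain ⟨⟨a, rfl⟩, ⟨b, rfl⟩⟩ := And.intro h1 h2
        exact ⟨a * b, map_mul ev a b⟩
  have hR' : ∀ f, f ∈ R.toSubring ↔ ev.IsIntegralElem f := by
    intro f
    rw [Subalgebra.mem_toSubring, hR]
    constructor <;> refine isIntegralElem_of_range_le ?_
    · rintro _ ⟨a, rfl⟩
      exact (hrange _).mpr a.2
    · exact fun a ha => ⟨⟨a, (hrange a).mp ha⟩, rfl⟩
  have hpt : f = Spec.map (CommRingCat.ofHom ev) ≫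
      Proj.awayι (grading k n) _ (hX j) one_pos :=
    hf.trans <| fromOfGlobalSections_eq (grading k n) g hg _ hge one_pos (hX j) hu
  obtain ⟨J, hJ1, hJ2, hJ3⟩ := exists_chart_normalization _ _ _ hpt R.toSubring hR'
  refine ⟨J, hJ1, ?_, ?_, ?_⟩
  · rw [reassoc_of% hJ2, projToBase, Proj.awayι_toSpecZero_assoc, ← Spec.map_comp,
      ← Spec.map_comp]
    congr 1
    refine CommRingCat.hom_ext (RingHom.ext fun c => Subtype.ext ?_)
    have h1 := hev 0 (.C (.C c)) (MvPolynomial.isHomogeneous_C _ _)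
    refine Eq.trans ?_ (h1.trans (by simp))
    refine congrArg ev (HomogeneousLocalization.val_injective _ ?_)
    refine Eq.trans (b := Localization.mk (MvPolynomial.C (Polynomial.C c)) 1) rfl
      (Eq.trans ?_ (HomogeneousLocalization.Away.val_mk _ _ _ _ _).symm)
    congr 1
  · intro y
    rw [hJ3, ← Proj.opensRange_awayι (grading k n) _ (hX j) one_pos]
    rfl
  · intro z i r hr
    rw [← Scheme.Hom.comp_apply, hJ2, Scheme.Hom.comp_apply]
    change _ ∈ Proj.awayι (grading k n) _ (hX j) one_pos ⁻¹ᵁ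
      Proj.basicOpen (grading k n) (MvPolynomial.X i) ↔ _
    rw [Proj.awayι_preimage_basicOpen (grading k n) (hX j) one_pos (hX i) one_pos]
    have h1 : ∀ (ψ : HomogeneousLocalization.Away (grading k n) (MvPolynomial.X j) →+*
        R.toSubring) a, Spec.map (CommRingCat.ofHom ψ) z ∈ PrimeSpectrum.basicOpen a ↔
        ψ a ∉ PrimeSpectrum.asIdeal z := fun _ _ => Iff.rfl
    refine (h1 _ _).trans (not_congr ?_)
    refine iff_of_eq (congrArg (· ∈ PrimeSpectrum.asIdeal z) (Subtype.ext ?_))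
    refine (hev _ _ _).trans ?_
    rw [hr, pow_one, MvPolynomial.eval₂_X]

section Charts

variable (k : Type u) [Field k] (n m q : ℕ)

/-- The rational function `t` on `Gⁿ`. -/
def tFun : FunField k n m q := baseHom k n m q Polynomial.X

theorem baseHom_C (c : k) : baseHom k n m q (Polynomial.C c) = algebraMap k _ c := by
  rw [baseHom, IsScalarTower.algebraMap_apply k (CoordRing k n m q) (FunField k n m q)]
  rfl

theorem baseHom_eq : baseHom k n m q = (Polynomial.aeval (tFun k n m q)).toRingHom := by
  refine Polynomial.ringHom_ext (fun c => ?_) ?_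
  · simp [baseHom_C]
  · simp [tFun]

variable [IsDomain (CoordRing k n m q)]

/-- The homogeneous coordinates `(1, x₁⁻¹, …, xₙ⁻¹)` of the generic point. -/
def coord : Fin (n + 1) → FunField k n m q := Fin.cons 1 fun i => (x k n m q i)⁻¹

theorem evalHom_eq : evalHom k n m q =
    MvPolynomial.eval₂Hom (baseHom k n m q) (coord k n m q) := by
  simp only [evalHom, coord, Ring.inverse_eq_inv']

theorem coord_ne_zero (hx : ∀ i, x k n m q i ≠ 0) (j : Fin (n + 1)) : coord k n m q j ≠ 0 := by
  refine Fin.cases ?_ (fun i => ?_) j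
  · simp [coord]
  · simp [coord, hx]

theorem exists_chart (hx : ∀ i, x k n m q i ≠ 0) (j : Fin (n + 1))
    (R : Subalgebra k (FunField k n m q))
    (hR : ∀ f, f ∈ R ↔ (algebraMap (chartRing k (tFun k n m q) (coord k n m q) j)
      (FunField k n m q)).IsIntegralElem f) :
    ∃ J : Spec (.of R) ⟶ Y k n m q, IsOpenImmersion J ∧
      J ≫ YToBase k n m q = Spec.map (CommRingCat.ofHom (algebraMap k R)) ∧
      (∀ y, y ∈ Set.range J ↔ (point k n m q).fromNormalization y ∈
        Proj.basicOpen (grading k n) (MvPolynomial.X j)) ∧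
      ∀ (z : Spec (.of R)) (i : Fin (n + 1)) (r : R),
        (r : FunField k n m q) = coord k n m q i / coord k n m q j →
        ((point k n m q).fromNormalization (J z) ∈
          Proj.basicOpen (grading k n) (MvPolynomial.X i) ↔ r ∉ PrimeSpectrum.asIdeal z) := by
  refine exists_chart_proj k _ _ (coord_ne_zero k n m q hx) (evalHomSpec k n m q)
    (irrelevant_map k n m q) (fun a => ?_) (point k n m q) rfl j R hR
  rw [← baseHom_eq, ← evalHom_eq]
  simp [evalHomSpec]

theorem exists_mem_basicOpen_X (k : Type u) [Field k] (n : ℕ) (y : ProjTimesLine k n) :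
    ∃ j, y ∈ Proj.basicOpen (grading k n) (MvPolynomial.X j) := by
  have h := Proj.iSup_basicOpen_eq_top' (grading k n) (fun j : Fin (n + 1) => MvPolynomial.X j)
    (fun j => ⟨1, MvPolynomial.isHomogeneous_X _ _⟩) (by
      rw [eq_top_iff]
      intro P _
      induction P using MvPolynomial.induction_on with
      | C c =>
        exact Subalgebra.algebraMap_mem _
          (⟨MvPolynomial.C c, MvPolynomial.isHomogeneous_C _ _⟩ : grading k n 0)
      | add _ _ h1 h2 => exact add_mem (h1 trivial) (h2 trivial)
      | mul_X _ i h1 => exact mul_mem (h1 trivial) (Algebra.subset_adjoin ⟨i, rfl⟩))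
  exact TopologicalSpace.Opens.mem_iSup.mp (h.ge (Set.mem_univ y))

/-- Every point of `𝒴` lies on the chart `Y₀ ≠ 0`, or on a chart `Yⱼ ≠ 0` for `j > 0`, at a point
where `xⱼ = Y₀ / Yⱼ` vanishes. -/
theorem exists_mem_chart (hx : ∀ i, x k n m q i ≠ 0)
    (R : Fin (n + 1) → Subalgebra k (FunField k n m q))
    (hR : ∀ j f, f ∈ R j ↔ (algebraMap (chartRing k (tFun k n m q) (coord k n m q) j)
      (FunField k n m q)).IsIntegralElem f) (y : Y k n m q) :
    ∃ (j : Fin (n + 1)) (J : Spec (.of (R j)) ⟶ Y k n m q) (z : Spec (.of (R j))),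
      IsOpenImmersion J ∧ J z = y ∧
      J ≫ YToBase k n m q = Spec.map (CommRingCat.ofHom (algebraMap k (R j))) ∧
      ∀ i : Fin n, j = i.succ → ∀ r : R j, (r : FunField k n m q) = x k n m q i →
        r ∈ PrimeSpectrum.asIdeal z := by
  by_cases h : (point k n m q).fromNormalization y ∈
      Proj.basicOpen (grading k n) (MvPolynomial.X 0)
  · obtain ⟨J, h1, h2, h3, -⟩ := exists_chart k n m q hx 0 (R 0) (hR 0)
    obtain ⟨z, hz⟩ := (h3 y).mpr h
    exact ⟨0, J, z, h1, hz, h2, fun i hi => (Fin.succ_ne_zero i hi.symm).elim⟩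
  · obtain ⟨j, hj⟩ := exists_mem_basicOpen_X k n ((point k n m q).fromNormalization y)
    obtain ⟨J, h1, h2, h3, h4⟩ := exists_chart k n m q hx j (R j) (hR j)
    obtain ⟨z, rfl⟩ := (h3 y).mpr hj
    refine ⟨j, J, z, h1, rfl, h2, fun i hi r hr => ?_⟩
    subst hi
    -- Y₀ / Yⱼ is the function xᵢ on this chart; were it invertible at z, the point would lie on the
    -- chart Y₀ ≠ 0.
    by_contra hrz
    exact h ((h4 z 0 r (by simp [hr, coord])).mpr hrz)

end Charts

/-! ### The coordinate ring of the product of curves -/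

/-- In a linear relation the leading term of largest degree has nothing to cancel against. -/
theorem linearIndependent_of_degree_injective {σ ι F : Type*} [Field F] (mo : MonomialOrder σ)
    (P : ι → MvPolynomial σ F) (h0 : ∀ i, P i ≠ 0)
    (hinj : Function.Injective fun i => mo.degree (P i)) : LinearIndependent F P := by
  rw [linearIndependent_iff]
  intro c hc
  by_contra hne
  obtain ⟨i, hi, hmax⟩ := c.support.exists_max_image (fun i => mo.toSyn (mo.degree (P i)))
    (Finsupp.support_nonempty_iff.mpr hne)
  have h1 := congrArg (MvPolynomial.coeff (mo.degree (P i))) hc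
  rw [Finsupp.linearCombination_apply, Finsupp.sum, MvPolynomial.coeff_sum,
    Finset.sum_eq_single i, MvPolynomial.coeff_smul, MvPolynomial.coeff_zero, smul_eq_mul,
    mul_eq_zero, mo.coeff_degree_eq_zero_iff] at h1
  · exact h1.elim (Finsupp.mem_support_iff.mp hi) (h0 i)
  · intro j hj hji
    rw [MvPolynomial.coeff_smul, mo.coeff_eq_zero_of_lt, smul_zero]
    exact lt_of_le_of_ne (hmax j hj) fun h => hji (hinj (mo.toSyn.injective h))
  · exact fun h => (h hi).elim

theorem injective_of_linearIndependent {K V W ι : Type*} [Field K] [AddCommGroup V] [Module K V]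
    [AddCommGroup W] [Module K W] (f : V →ₗ[K] W) (v : ι → V)
    (hv : Submodule.span K (Set.range v) = ⊤) (h : LinearIndependent K (f ∘ v)) :
    Function.Injective f := by
  rw [injective_iff_map_eq_zero]
  intro a ha
  obtain ⟨c, rfl⟩ : a ∈ LinearMap.range (Finsupp.linearCombination K v) := by
    rw [Finsupp.range_linearCombination, hv]; trivial
  have : c = 0 := by
    refine (linearIndependent_iff.mp h) c ?_
    rw [← ha, Finsupp.apply_linearCombination]
  rw [this, map_zero]

theorem degree_X_pow_add_C {σ F : Type*} [Field F] (mo : MonomialOrder σ) (i : σ) {m : ℕ}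
    (hm : m ≠ 0) (s : F) : mo.degree (MvPolynomial.X i ^ m + MvPolynomial.C s) =
      Finsupp.single i m := by
  have h : mo.degree (MvPolynomial.X i ^ m : MvPolynomial σ F) = Finsupp.single i m := by
    rw [mo.degree_pow, mo.degree_X]; simp
  rw [mo.degree_add_of_lt, h]
  rw [h, mo.degree_C, map_zero]
  exact mo.toSyn_lt_iff_ne_zero.mpr (by simpa using hm)

/-- Monomials `x^α u^β`. -/
def monom {A ι : Type*} [CommRing A] [Fintype ι] (x u : ι → A) (α β : ι → ℕ) : A :=
  ∏ i, x i ^ α i * u i ^ β i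

/-- With s = t^(1/q) this is the leading exponent of the image of x^α u^β in the polynomial ring of
`exists_injective_coordRing`. -/
theorem degree_monom {n m q : ℕ} {F : Type*} [Field F] (mo : MonomialOrder (Fin n)) (hm : m ≠ 0)
    (s : F) (α β : Fin n → ℕ) :
    (monom (fun i => MvPolynomial.X i ^ q) (fun i => MvPolynomial.X i ^ m + MvPolynomial.C s) α β
      : MvPolynomial (Fin n) F) ≠ 0 ∧
    ∀ i, mo.degree (monom (fun i => MvPolynomial.X i ^ q)
      (fun i => MvPolynomial.X i ^ m + MvPolynomial.C s) α β : MvPolynomial (Fin n) F) i =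
        q * α i + m * β i := by
  have h0 : ∀ i : Fin n,
      (MvPolynomial.X i ^ m + MvPolynomial.C s : MvPolynomial (Fin n) F) ≠ 0 := by
    intro i h
    have := degree_X_pow_add_C mo i hm s
    rw [h, mo.degree_zero] at this
    exact hm (by simpa using congrArg (fun f => f i) this.symm)
  have h1 : ∀ i ∈ Finset.univ, ((MvPolynomial.X i ^ q) ^ α i *
      (MvPolynomial.X i ^ m + MvPolynomial.C s) ^ β i : MvPolynomial (Fin n) F) ≠ 0 := fun i _ =>
    mul_ne_zero (pow_ne_zero _ (pow_ne_zero _ (MvPolynomial.X_ne_zero i))) (pow_ne_zero _ (h0 i))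
  refine ⟨Finset.prod_ne_zero_iff.mpr h1, fun i => ?_⟩
  rw [monom, mo.degree_prod h1, Finsupp.finsetSum_apply, Finset.sum_eq_single i]
  · rw [mo.degree_mul (pow_ne_zero _ (pow_ne_zero _ (MvPolynomial.X_ne_zero i)))
      (pow_ne_zero _ (h0 i)), mo.degree_pow, mo.degree_pow, mo.degree_pow, mo.degree_X,
      degree_X_pow_add_C mo i hm]
    simp
    ring
  · intro j _ hj
    rw [mo.degree_mul (pow_ne_zero _ (pow_ne_zero _ (MvPolynomial.X_ne_zero j)))
      (pow_ne_zero _ (h0 j)), mo.degree_pow, mo.degree_pow, mo.degree_pow, mo.degree_X,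
      degree_X_pow_add_C mo j hm]
    simp [hj]
  · simp

/-- Reducing mod q and cancelling m determines b. It follows that the monomials x^α u^β with all βᵢ
< q have images with distinct leading exponents. -/
theorem eq_of_mul_add_mul {q m a b a' b' : ℕ} (hqm : q.Coprime m) (hb : b < q) (hb' : b' < q)
    (h : q * a + m * b = q * a' + m * b') : a = a' ∧ b = b' := by
  have h1 : m * b ≡ m * b' [MOD q] := by
    have := congrArg (· % q) h
    simpa [Nat.ModEq, Nat.mul_add_mod] using this
  have h2 : b = b' := by
    have := Nat.ModEq.cancel_left_of_coprime hqm h1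
    rwa [Nat.ModEq, Nat.mod_eq_of_lt hb, Nat.mod_eq_of_lt hb'] at this
  subst h2
  exact ⟨Nat.eq_of_mul_eq_mul_left (by omega) (by omega : q * a = q * a'), rfl⟩

theorem prod_pow_single {A ι : Type*} [CommRing A] [Fintype ι] [DecidableEq ι] (x : ι → A)
    (i : ι) (d : ℕ) : ∏ j, x j ^ (Pi.single i d : ι → ℕ) j = x i ^ d := by
  rw [Finset.prod_eq_single i (fun j _ hj => by simp [hj]) (by simp), Pi.single_eq_same]

theorem monom_mul_left {A ι : Type*} [CommRing A] [Fintype ι] [DecidableEq ι] (x u : ι → A)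
    (α β : ι → ℕ) (i : ι) (d : ℕ) :
    monom x u α β * x i ^ d = monom x u (α + Pi.single i d) β := by
  simp only [monom, Pi.add_apply, pow_add, Finset.prod_mul_distrib, prod_pow_single]
  ring

theorem monom_mul_right {A ι : Type*} [CommRing A] [Fintype ι] [DecidableEq ι] (x u : ι → A)
    (α β : ι → ℕ) (i : ι) (d : ℕ) :
    monom x u α β * u i ^ d = monom x u α (β + Pi.single i d) := by
  simp only [monom, Pi.add_apply, pow_add, Finset.prod_mul_distrib, prod_pow_single]
  ring

theorem span_monom {K A ι : Type*} [Field K] [CommRing A] [Algebra K A] [Fintype ι]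
    [DecidableEq ι] (x u : ι → A) {q m : ℕ} (hq : 0 < q) (s : K)
    (hrel : ∀ i, u i ^ q = x i ^ m + algebraMap K A s)
    (hgen : Algebra.adjoin K (Set.range x ∪ Set.range u) = ⊤) :
    Submodule.span K (Set.range fun γ : (ι → ℕ) × (ι → Fin q) =>
      monom x u γ.1 fun i => γ.2 i) = ⊤ := by
  set V := Submodule.span K (Set.range fun γ : (ι → ℕ) × (ι → Fin q) =>
      monom x u γ.1 fun i => γ.2 i) with hV
  have hmem : ∀ α β : ι → ℕ, (∀ i, β i < q) → monom x u α β ∈ V := fun α β hβ =>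
    Submodule.subset_span ⟨(α, fun i => ⟨β i, hβ i⟩), rfl⟩
  have hx : ∀ i d, ∀ a ∈ V, a * x i ^ d ∈ V := by
    intro i d a ha
    induction ha using Submodule.span_induction with
    | mem a ha =>
      obtain ⟨γ, rfl⟩ := ha
      dsimp only
      rw [monom_mul_left]
      exact hmem _ _ fun i => (γ.2 i).2
    | zero => simp
    | add a b _ _ h1 h2 => rw [add_mul]; exact add_mem h1 h2
    | smul c a _ h => rw [smul_mul_assoc]; exact V.smul_mem c h
  have hu : ∀ i, ∀ a ∈ V, a * u i ∈ V := by
    intro i a ha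
    induction ha using Submodule.span_induction with
    | mem a ha =>
      obtain ⟨γ, rfl⟩ := ha
      dsimp only
      by_cases h : (γ.2 i : ℕ) + 1 < q
      · have := monom_mul_right x u γ.1 (fun i => γ.2 i) i 1
        rw [pow_one] at this
        rw [this]
        refine hmem _ _ fun j => ?_
        by_cases hj : j = i
        · subst hj; simpa using h
        · simp [hj]
      · have hi : (γ.2 i : ℕ) = q - 1 := by have := (γ.2 i).2; omega
        -- `β'` drops the exponent q - 1 of uᵢ; multiplication by uᵢ then produces uᵢ^q, which the
        -- relation replaces by xᵢ^m + s.
        set β' : ι → ℕ := fun j => if j = i then 0 else γ.2 j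
        have h1 : (fun j => (γ.2 j : ℕ)) = β' + Pi.single i (q - 1) := by
          funext j
          by_cases hj : j = i
          · subst hj; simp [β', hi]
          · simp [β', hj]
        have hβ' : ∀ j, β' j < q := by
          intro j
          by_cases hj : j = i
          · simp [β', hj, hq]
          · simp [β', hj]
        rw [h1, ← monom_mul_right, mul_assoc, ← pow_succ, Nat.sub_add_cancel hq, hrel, mul_add]
        refine add_mem (hx _ _ _ (hmem _ _ hβ')) ?_
        rw [← Algebra.commutes, ← Algebra.smul_def]
        exact V.smul_mem _ (hmem _ _ hβ')
    | zero => simp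
    | add a b _ _ h1 h2 => rw [add_mul]; exact add_mem h1 h2
    | smul c a _ h => rw [smul_mul_assoc]; exact V.smul_mem c h
  have h1 : (1 : A) ∈ V := by
    have := hmem 0 0 (fun _ => hq)
    simpa [monom] using this
  have hall : ∀ b ∈ Algebra.adjoin K (Set.range x ∪ Set.range u), ∀ a ∈ V, a * b ∈ V := by
    intro b hb
    induction hb using Algebra.adjoin_induction with
    | mem b hb =>
      rcases hb with ⟨i, rfl⟩ | ⟨i, rfl⟩
      · intro a ha; simpa using hx i 1 a ha
      · exact hu i
    | algebraMap c =>
      intro a ha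
      rw [← Algebra.commutes, ← Algebra.smul_def]
      exact V.smul_mem _ ha
    | add _ _ _ _ h1 h2 => intro a ha; rw [mul_add]; exact add_mem (h1 a ha) (h2 a ha)
    | mul _ _ _ _ h1 h2 => intro a ha; rw [← mul_assoc]; exact h2 _ (h1 a ha)
  rw [eq_top_iff]
  intro b _
  rw [← one_mul b]
  exact hall b (by rw [hgen]; trivial) 1 h1

/-- The coordinate ring embeds into a polynomial ring, by `xᵢ ↦ τᵢ^q`, `uᵢ ↦ τᵢ^m + t^(1/q)`. -/
theorem exists_injective_coordRing (k : Type u) [Field k] (p : ℕ) [Fact p.Prime] [CharP k p]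
    (n m e : ℕ) (hm : m ≠ 0) (hpm : ¬ p ∣ m) :
    ∃ ρ : CoordRing k n m (p ^ e) →ₐ[RatFunc k]
      MvPolynomial (Fin n) (AlgebraicClosure (RatFunc k)), Function.Injective ρ ∧
        ∀ i, ρ (Ideal.Quotient.mk _ (.X (.inl i))) = .X i ^ p ^ e := by
  have hq : 0 < p ^ e := pow_pos (Nat.Prime.pos Fact.out) e
  -- s = t^(1/q), so that (τᵢ^m + s)^q = (τᵢ^q)^m + t by Frobenius.
  obtain ⟨s, hs⟩ := IsAlgClosed.exists_pow_nat_eq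
    (algebraMap (RatFunc k) (AlgebraicClosure (RatFunc k)) RatFunc.X) hq
  have : CharP (AlgebraicClosure (RatFunc k)) p :=
    charP_of_injective_algebraMap (algebraMap k _).injective p
  let r : MvPolynomial (Fin n ⊕ Fin n) (RatFunc k) →ₐ[RatFunc k]
      MvPolynomial (Fin n) (AlgebraicClosure (RatFunc k)) :=
    MvPolynomial.aeval (Sum.elim (fun i => .X i ^ p ^ e) fun i => .X i ^ m + .C s)
  have hr : ∀ a ∈ Ideal.span (Set.range fun i : Fin n =>
      (MvPolynomial.X (Sum.inr i) ^ p ^ e - MvPolynomial.X (Sum.inl i) ^ m -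
        MvPolynomial.C RatFunc.X : MvPolynomial (Fin n ⊕ Fin n) (RatFunc k))), r a = 0 := by
    intro a ha
    refine (Ideal.span_le (I := RingHom.ker r)).mpr ?_ ha
    rintro _ ⟨i, rfl⟩
    change r _ = 0
    simp only [r, map_sub, map_pow, MvPolynomial.aeval_X, Sum.elim_inl, Sum.elim_inr,
      add_pow_char_pow, MvPolynomial.aeval_C, MvPolynomial.algebraMap_eq,
      IsScalarTower.algebraMap_apply (RatFunc k) (AlgebraicClosure (RatFunc k))
        (MvPolynomial (Fin n) (AlgebraicClosure (RatFunc k))), ← hs]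
    ring
  let ρ : CoordRing k n m (p ^ e) →ₐ[RatFunc k] _ := Ideal.Quotient.liftₐ _ r hr
  have hρ : ∀ a, ρ (Ideal.Quotient.mk _ a) = r a := fun a => rfl
  have hx : ∀ i, ρ (Ideal.Quotient.mk _ (.X (.inl i))) = .X i ^ p ^ e := by simp [hρ, r]
  have hu : ∀ i, ρ (Ideal.Quotient.mk _ (.X (.inr i))) = .X i ^ m + .C s := by simp [hρ, r]
  refine ⟨ρ, ?_, hx⟩
  let X : Fin n → CoordRing k n m (p ^ e) := fun i => Ideal.Quotient.mk _ (.X (.inl i))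
  let U : Fin n → CoordRing k n m (p ^ e) := fun i => Ideal.Quotient.mk _ (.X (.inr i))
  refine injective_of_linearIndependent ρ.toLinearMap _
    (span_monom (m := m) X U hq RatFunc.X (fun i => ?_) ?_) ?_
  · rw [← sub_eq_zero, ← sub_sub]
    exact Ideal.Quotient.eq_zero_iff_mem.mpr (Ideal.subset_span ⟨i, rfl⟩)
  · rw [eq_top_iff]
    rintro a -
    obtain ⟨a, rfl⟩ := Ideal.Quotient.mk_surjective a
    induction a using MvPolynomial.induction_on with
    | C c => exact Subalgebra.algebraMap_mem _ c
    | add a b h1 h2 => rw [map_add]; exact add_mem h1 h2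
    | mul_X a i h =>
      rw [map_mul]
      refine mul_mem h (Algebra.subset_adjoin ?_)
      rcases i with i | i
      exacts [Or.inl ⟨i, rfl⟩, Or.inr ⟨i, rfl⟩]
  · have hdeg := fun γ : (Fin n → ℕ) × (Fin n → Fin (p ^ e)) =>
      degree_monom (q := p ^ e) MonomialOrder.lex hm s γ.1 fun i => γ.2 i
    have h1 := linearIndependent_of_degree_injective MonomialOrder.lex _ (fun γ => (hdeg γ).1) (by
      intro γ γ' h
      have h2 : ∀ i, γ.1 i = γ'.1 i ∧ (γ.2 i : ℕ) = γ'.2 i := fun i => by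
        refine eq_of_mul_add_mul (Nat.Coprime.pow_left e
          ((Nat.Prime.coprime_iff_not_dvd Fact.out).mpr hpm)) (γ.2 i).2 (γ'.2 i).2 ?_
        rw [← (hdeg γ).2 i, ← (hdeg γ').2 i]
        exact congrArg (fun f => f i) h
      exact Prod.ext (funext fun i => (h2 i).1) (funext fun i => Fin.ext (h2 i).2))
    have h3 := h1.restrict_scalars' (RatFunc k)
    have h4 : (ρ ∘ fun γ : (Fin n → ℕ) × (Fin n → Fin (p ^ e)) => monom X U γ.1 fun i => γ.2 i) =
        fun γ => monom (fun i => .X i ^ p ^ e) (fun i => .X i ^ m + .C s) γ.1 fun i => γ.2 i := by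
      funext γ
      simp [monom, X, U, hx, hu]
    rw [← h4] at h3
    exact h3

/-- The rational function `uᵢ` on `Gⁿ`. -/
def uFun (k : Type u) [Field k] (n m q : ℕ) (i : Fin n) : FunField k n m q :=
  algebraMap (CoordRing k n m q) _ (Ideal.Quotient.mk _ (MvPolynomial.X (Sum.inr i)))

theorem uFun_pow (k : Type u) [Field k] (n m q : ℕ) (i : Fin n) :
    uFun k n m q i ^ q = x k n m q i ^ m + tFun k n m q := by
  have h : (Ideal.Quotient.mk _ (MvPolynomial.X (Sum.inr i)) : CoordRing k n m q) ^ q =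
      Ideal.Quotient.mk _ (MvPolynomial.X (Sum.inl i)) ^ m +
        Ideal.Quotient.mk _ (MvPolynomial.C RatFunc.X) := by
    rw [← sub_eq_zero, ← sub_sub]
    exact Ideal.Quotient.eq_zero_iff_mem.mpr (Ideal.subset_span ⟨i, rfl⟩)
  rw [uFun, ← map_pow, h, map_add, map_pow]
  simp [x, tFun, baseHom]

theorem isDomain_coordRing (k : Type u) [Field k] (p : ℕ) [Fact p.Prime] [CharP k p]
    (n m e : ℕ) (hm : m ≠ 0) (hpm : ¬ p ∣ m) : IsDomain (CoordRing k n m (p ^ e)) := by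
  obtain ⟨ρ, hρ, -⟩ := exists_injective_coordRing k p n m e hm hpm
  exact hρ.isDomain ρ.toRingHom

/-- After the embedding of `exists_injective_coordRing`, the evaluation becomes the inclusion of
k[t] into the algebraic closure of k(t) on coefficients followed by Xᵢ ↦ Xᵢ^q. Both are injective.
-/
theorem injective_aeval_funField (k : Type u) [Field k] (p : ℕ) [Fact p.Prime] [CharP k p]
    (n m e : ℕ) (hm : m ≠ 0) (hpm : ¬ p ∣ m) :
    Function.Injective (MvPolynomial.aeval (R := k) fun i : Option (Fin n) =>
      i.elim (tFun k n m (p ^ e)) (x k n m (p ^ e))) := by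
  obtain ⟨ρ, -, hρ⟩ := exists_injective_coordRing k p n m e hm hpm
  have hq : 0 < p ^ e := pow_pos (Nat.Prime.pos Fact.out) e
  have := isDomain_coordRing k p n m e hm hpm
  let η : MvPolynomial (Option (Fin n)) k →ₐ[k] CoordRing k n m (p ^ e) :=
    MvPolynomial.aeval fun i : Option (Fin n) =>
      i.elim (algebraMap (RatFunc k) _ RatFunc.X) fun i => Ideal.Quotient.mk _ (.X (.inl i))
  have h1 : MvPolynomial.aeval (R := k) (fun i : Option (Fin n) =>
      i.elim (tFun k n m (p ^ e)) (x k n m (p ^ e))) =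
      (IsScalarTower.toAlgHom k (CoordRing k n m (p ^ e)) (FunField k n m (p ^ e))).comp η := by
    refine MvPolynomial.algHom_ext fun i => ?_
    rcases i with _ | i
    · simp [η, tFun, baseHom]
      rfl
    · simp [η, x]
  have h2 : Function.Injective (ρ.toRingHom.comp η.toRingHom) := by
    have h3 : ρ.toRingHom.comp η.toRingHom =
        ((MvPolynomial.expand (p ^ e)).toRingHom.comp (MvPolynomial.map ((algebraMap (RatFunc k)
          (AlgebraicClosure (RatFunc k))).comp (algebraMap (Polynomial k) (RatFunc k))))).comp
          (MvPolynomial.optionEquivRight k (Fin n)).toRingEquiv.toRingHom := by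
      refine MvPolynomial.ringHom_ext (fun c => ?_) fun i => ?_
      · have h4 : η (.C c) = algebraMap (RatFunc k) _ (algebraMap k (RatFunc k) c) :=
          (η.commutes c).trans (IsScalarTower.algebraMap_apply k (RatFunc k) _ c)
        change ρ (η _) = MvPolynomial.expand (p ^ e) (MvPolynomial.map _
          (MvPolynomial.optionEquivRight k (Fin n) _))
        rw [h4, ρ.commutes, MvPolynomial.optionEquivRight_C, MvPolynomial.map_C,
          MvPolynomial.expand_C]
        rfl
      · change ρ (η _) = MvPolynomial.expand (p ^ e) (MvPolynomial.map _
          (MvPolynomial.optionEquivRight k (Fin n) _))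
        rcases i with _ | i
        · rw [MvPolynomial.aeval_X, MvPolynomial.optionEquivRight_X_none, MvPolynomial.map_C,
            MvPolynomial.expand_C, RingHom.comp_apply, RatFunc.algebraMap_X]
          exact ρ.commutes _
        · rw [MvPolynomial.aeval_X, MvPolynomial.optionEquivRight_X_some, MvPolynomial.map_X,
            MvPolynomial.expand_X]
          exact hρ i
    rw [h3]
    refine ((MvPolynomial.expand_injective hq).comp (MvPolynomial.map_injective _ ?_)).comp
      (MvPolynomial.optionEquivRight k (Fin n)).injective
    exact (algebraMap (RatFunc k) (AlgebraicClosure (RatFunc k))).injective.comp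
      (RatFunc.algebraMap_injective k)
  rw [h1]
  exact (IsFractionRing.injective (CoordRing k n m (p ^ e)) (FunField k n m (p ^ e))).comp
    (Function.Injective.of_comp (f := ρ) h2)

theorem subfield_eq_top (k : Type u) [Field k] (n m q : ℕ) [IsDomain (CoordRing k n m q)]
    (F : Subfield (FunField k n m q)) (hk : ∀ c : k, algebraMap k _ c ∈ F)
    (ht : tFun k n m q ∈ F) (hx : ∀ i, x k n m q i ∈ F) (hu : ∀ i, uFun k n m q i ∈ F) :
    F = ⊤ := by
  have hK : ∀ c : RatFunc k, algebraMap (CoordRing k n m q) (FunField k n m q)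
      (algebraMap (RatFunc k) _ c) ∈ F := by
    intro c
    have h1 : ∀ a : Polynomial k, baseHom k n m q a ∈ F := by
      intro a
      rw [baseHom_eq]
      induction a using Polynomial.induction_on' with
      | add a b h1 h2 => rw [map_add]; exact add_mem h1 h2
      | monomial d c =>
        rw [AlgHom.toRingHom_eq_coe, RingHom.coe_coe, Polynomial.aeval_monomial]
        exact mul_mem (hk c) (pow_mem ht d)
    induction c using RatFunc.induction_on with
    | f a b hb =>
      change ((algebraMap (CoordRing k n m q) (FunField k n m q)).comp
        (algebraMap (RatFunc k) _)) _ ∈ F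
      rw [map_div₀]
      exact div_mem (h1 a) (h1 b)
  rw [eq_top_iff]
  intro a _
  obtain ⟨a, b, hb, rfl⟩ := IsFractionRing.div_surjective (A := CoordRing k n m q) a
  have h : ∀ a : CoordRing k n m q, algebraMap _ (FunField k n m q) a ∈ F := by
    intro a
    obtain ⟨a, rfl⟩ := Ideal.Quotient.mk_surjective a
    induction a using MvPolynomial.induction_on with
    | C c => exact hK c
    | add a b h1 h2 => rw [map_add, map_add]; exact add_mem h1 h2
    | mul_X a i h =>
      rw [map_mul, map_mul]
      refine mul_mem h ?_
      rcases i with i | i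
      exacts [hx i, hu i]
  exact div_mem (h a) (h b)

/-! ### Local structure at a prime of a chart -/

/-- The elements algebraic over k[g] form a subfield closed under q-th roots, so by `hg` they are
all of L. Since f bounds the transcendence degree below by the number of the gᵢ, these must be
independent. -/
theorem algebraicIndependent_of_generates {σ : Type} {k L : Type u} [Field k] [Finite σ] [Field L]
    [Algebra k L] {f : σ → L} (hf : AlgebraicIndependent k f) (g : σ → L) {q : ℕ} (hq : 0 < q)
    (hg : ∀ F : Subfield L, (∀ c, algebraMap k L c ∈ F) → (∀ i, g i ∈ F) →
      (∀ a, a ^ q ∈ F → a ∈ F) → F = ⊤) : AlgebraicIndependent k g := by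
  let A := Algebra.adjoin k (Set.range g)
  let F : Subfield L :=
    { carrier := {a | IsAlgebraic A a}
      mul_mem' := fun ha hb => ha.mul hb
      one_mem' := isAlgebraic_one
      add_mem' := fun ha hb => ha.add hb
      zero_mem' := isAlgebraic_zero
      neg_mem' := fun ha => ha.neg
      inv_mem' := fun _ ha => ha.inv }
  have hF : F = ⊤ := by
    refine hg F (fun c => ?_) (fun i => ?_) (fun a ha => ?_)
    · exact isAlgebraic_algebraMap (A := L) (algebraMap k A c)
    · exact isAlgebraic_algebraMap (A := L) (⟨g i, Algebra.subset_adjoin ⟨i, rfl⟩⟩ : A)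
    · exact IsAlgebraic.of_pow hq ha
  have : Algebra.IsAlgebraic (Algebra.adjoin k (Set.range g)) L :=
    ⟨fun a => (hF.ge (Subfield.mem_top a) : a ∈ F)⟩
  exact (Algebra.IsAlgebraic.isTranscendenceBasis_of_lift_le_trdeg_of_finite k g
    hf.lift_cardinalMk_le_trdeg).1

theorem exists_eq_pow_of_X {k σ T : Type*} [Field k] [CommRing T] [Algebra k T] {p e : ℕ}
    [Fact p.Prime] [CharP k p] (τ : T →ₐ[k] MvPolynomial σ k)
    (h : ∀ i, ∃ s, τ s = .X i ^ p ^ e) (f : MvPolynomial σ k) : ∃ s, τ s = f ^ p ^ e := by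
  induction f using MvPolynomial.induction_on with
  | C c => exact ⟨algebraMap k T (c ^ p ^ e), by
      rw [τ.commutes, MvPolynomial.algebraMap_eq, map_pow]⟩
  | add f g hf hg =>
    obtain ⟨⟨s, hs⟩, ⟨s', hs'⟩⟩ := And.intro hf hg
    exact ⟨s + s', by rw [map_add, hs, hs', add_pow_char_pow]⟩
  | mul_X f i hf =>
    obtain ⟨⟨s, hs⟩, ⟨s', hs'⟩⟩ := And.intro hf (h i)
    exact ⟨s * s', by rw [map_mul, hs, hs', mul_pow]⟩

/-- The inclusion of a polynomial ring into its integral closure `R` in a field. -/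
def toClosure {σ : Type} {k L : Type u} [Field k] [Field L] [Algebra k L]
    (θ : MvPolynomial σ k →ₐ[k] L) (R : Subalgebra k L)
    (hR : ∀ f, f ∈ R ↔ θ.toRingHom.IsIntegralElem f) : MvPolynomial σ k →ₐ[k] R :=
  θ.codRestrict R fun _ => (hR _).mpr θ.toRingHom.isIntegralElem_map

theorem isRegularLocalRing_atPrime_of_away {R S : Type*} [CommRing R] [CommRing S] [Algebra R S]
    (r : R) [IsLocalization.Away r S] (P : Ideal R) [P.IsPrime] (hr : r ∉ P)
    (h : ∀ Q : Ideal S, ∀ _ : Q.IsPrime, IsRegularLocalRing (Localization.AtPrime Q)) :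
    IsRegularLocalRing (Localization.AtPrime P) := by
  have hdisj : Disjoint (Submonoid.powers r : Set R) (P : Set R) := by
    rw [Set.disjoint_left]
    rintro _ ⟨n, rfl⟩ hn
    exact hr (‹P.IsPrime›.mem_of_pow_mem n hn)
  have hQ := IsLocalization.isPrime_of_isPrime_disjoint (.powers r) S P ‹_› hdisj
  have hc := IsLocalization.under_map_of_isPrime_disjoint (.powers r) S ‹P.IsPrime› hdisj
  set Q := P.map (algebraMap R S) with hQdef
  have h1 := IsLocalization.isLocalization_isLocalization_atPrime_isLocalization (.powers r)
    (Localization.AtPrime Q) Q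
  have h2 : Q.comap (algebraMap R S) = P := hc
  simp only [h2] at h1
  have := h Q hQ
  exact IsRegularLocalRing.of_ringEquiv
    (IsLocalization.algEquiv P.primeCompl (Localization.AtPrime Q)
      (Localization.AtPrime P)).toRingEquiv

/-- The case of `exists_etale_localization` in which T is a polynomial ring, mapped to L by the
roots wᵢ of the coordinates ψᵢ; νᵢ = 1 allows a coordinate of which no root is taken. The condition
`hder` says that the ψᵢ are étale coordinates where d ≠ 0. -/
theorem isRegularLocalRing_of_chart {σ : Type} {k L : Type u} [Field k] [Finite σ] [Field L]
    [Algebra k L]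
    {p e : ℕ} [Fact p.Prime] [CharP k p] (θ : MvPolynomial σ k →ₐ[k] L)
    (hθ : Function.Injective θ) (R : Subalgebra k L)
    (hR : ∀ f, f ∈ R ↔ θ.toRingHom.IsIntegralElem f)
    (ψ : σ → MvPolynomial σ k) (w : σ → L) (ν : σ → ℕ) (hν : ∀ i, ν i ∣ p ^ e)
    (hw : ∀ i, w i ^ ν i = θ (ψ i)) (d : MvPolynomial σ k)
    (hder : ∀ (M : Type u) [AddCommGroup M] [Module k M] [Module (MvPolynomial σ k) M]
      [IsScalarTower k (MvPolynomial σ k) M] (D : Derivation k (MvPolynomial σ k) M),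
      (∀ x : M, d • x = 0 → x = 0) → (∀ i, D (ψ i) = 0) → ∀ i, D (.X i) = 0)
    (hgen : ∀ F : Subfield L, (∀ c, algebraMap k L c ∈ F) → (∀ i, θ (.X i) ∈ F) →
      (∀ i, w i ∈ F) → F = ⊤) (P : Ideal R) [P.IsPrime] (hd : toClosure θ R hR d ∉ P) :
    IsRegularLocalRing (Localization.AtPrime P) := by
  have : CharP L p := charP_of_injective_algebraMap (algebraMap k L).injective p
  obtain ⟨S, hRS, φ, hφ, hφχ, r, hr, hloc⟩ := exists_etale_localization (p := p) (e := e) θ hθ R hR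
    (MvPolynomial.aeval ψ) (MvPolynomial.aeval fun i => (.X i ^ ν i : MvPolynomial σ k))
    (MvPolynomial.aeval w) (by simp [hw]) (exists_eq_pow_of_X _ fun i => by
      obtain ⟨c, hc⟩ := hν i
      exact ⟨.X i ^ c, by rw [map_pow, MvPolynomial.aeval_X, ← pow_mul, ← hc]⟩) d
    (fun h => hd (by
      rw [show toClosure θ R hR d = 0 from Subtype.ext h]; exact zero_mem _))
    (fun M _ _ _ _ D h1 h2 => hder M D h1 (by simpa using h2))
    (fun F h1 h2 h3 => hgen F h1 h2 fun i => by simpa using h3 (.X i))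
  obtain rfl : r = toClosure θ R hR d := Subtype.ext hr
  let := (Subalgebra.inclusion hRS).toRingHom.toAlgebra
  have := hloc
  refine isRegularLocalRing_atPrime_of_away (S := S) _ P hd fun Q hQ => ?_
  let := φ.toAlgebra
  have : Algebra.Etale (MvPolynomial σ k) S := hφ
  exact isRegularLocalRing_of_etale (MvPolynomial σ k) Q

/-! ### Derivations of the coordinate changes -/

section Derivation

variable {k A M : Type*} [Field k] [CommRing A] [Algebra k A] [AddCommGroup M] [Module k M]
  [Module A M] (D : Derivation k A M)

theorem derivation_one_add {s y : A} (hs : D s = 0) {m : ℕ} (hm : m ≠ 0) :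
    y • D (1 + s * y ^ m) = ((m : A) * (s * y ^ m)) • D y := by
  obtain ⟨m, rfl⟩ := Nat.exists_eq_succ_of_ne_zero hm
  rw [map_add, D.map_one_eq_zero, D.leibniz, D.leibniz_pow, hs, zero_add, smul_zero, add_zero,
    ← Nat.cast_smul_eq_nsmul A]
  simp only [smul_smul]
  congr 1
  simp [pow_succ]
  ring

/-- Write g = 1 + s y^m. Logarithmically, dlog(y g^a) = (1 + m a (g - 1) / g) dlog y = g⁻¹ dlog y,
because q = 0 makes m a = -1. So y g^a can replace the coordinate y where g is invertible. -/
theorem derivation_mul_pow {s y : A} (hs : D s = 0) {m a b q : ℕ} (hm : m ≠ 0)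
    (hq : (q : A) = 0) (hab : q * b = 1 + m * a) :
    (1 + s * y ^ m) • D (y * (1 + s * y ^ m) ^ a) = (1 + s * y ^ m) ^ a • D y := by
  have h1 := derivation_one_add D (y := y) hs hm
  set g := 1 + s * y ^ m with hg
  have h2 : (g * y) • D (g ^ a) = (a * g ^ a) • (y • D g) := by
    rcases a with _ | a
    · simp
    · rw [D.leibniz_pow, ← Nat.cast_smul_eq_nsmul A]
      simp only [smul_smul]
      congr 1
      simp [pow_succ]
      ring
  have h3 : (m * a : A) = -1 := by
    have := congrArg (Nat.cast (R := A)) hab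
    push_cast at this
    rw [hq, zero_mul] at this
    linear_combination -this
  rw [D.leibniz, smul_add, smul_smul, h2, h1]
  simp only [smul_smul, ← add_smul]
  congr 1
  linear_combination (g ^ a * (s * y ^ m)) * h3 + g ^ a * hg

/-- The element is formally y^(qm) (y^(-m) + s), and y^(qm) is a constant for D since q = 0. When m
is a unit it can replace the coordinate y where y is invertible. The bound 2 ≤ q keeps the exponent
q m - m - 1 from being truncated. -/
theorem derivation_pow_mul {s y : A} (hs : D s = 0) {m q : ℕ} (hm : m ≠ 0) (hq2 : 2 ≤ q)
    (hq : (q : A) = 0) :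
    D (y ^ (q * m - m) * (1 + s * y ^ m)) = (-m * y ^ (q * m - m - 1) : A) • D y := by
  obtain ⟨q, rfl⟩ := Nat.exists_eq_add_of_le hq2
  obtain ⟨m, rfl⟩ := Nat.exists_eq_succ_of_ne_zero hm
  have e1 : (2 + q) * (m + 1) - (m + 1) = (q * (m + 1) + m) + 1 := by
    rw [show (2 + q) * (m + 1) = (q * (m + 1) + m + 1) + (m + 1) by ring]; omega
  have hq' : (2 + q : A) = 0 := by exact_mod_cast hq
  rw [e1, D.leibniz, map_add, D.map_one_eq_zero, D.leibniz s, D.leibniz_pow, D.leibniz_pow, hs,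
    zero_add, smul_zero, add_zero, ← Nat.cast_smul_eq_nsmul A, ← Nat.cast_smul_eq_nsmul A]
  simp only [smul_smul, ← add_smul, Nat.add_sub_cancel]
  congr 1
  push_cast
  simp only [Nat.succ_eq_add_one]
  linear_combination y ^ (q * (m + 1) + m) * (m + 1) * (1 + s * y ^ (m + 1)) * hq'

theorem derivation_mul_of_eq_zero {c y : A} (hc : D c = 0) : D (c * y) = c • D y := by
  rw [D.leibniz, hc, smul_zero, add_zero]

end Derivation

/-! ### The charts of the product of curves -/

/-- The field `L` is generated over `k` by `t`, `xᵢ` and `uᵢ` with `uᵢ^q = xᵢ^m + t`, where `t` and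
the `xᵢ` are algebraically independent. -/
structure IsProductField (k : Type u) {L : Type u} [Field k] [Field L] [Algebra k L] {n : ℕ}
    (m q : ℕ) (t : L) (x u : Fin n → L) : Prop where
  rel : ∀ i, u i ^ q = x i ^ m + t
  indep : AlgebraicIndependent k fun i : Option (Fin n) => i.elim t x
  gen : ∀ F : Subfield L, (∀ c, algebraMap k L c ∈ F) → t ∈ F → (∀ i, x i ∈ F) →
    (∀ i, u i ∈ F) → F = ⊤

theorem mem_of_pow_mem {L : Type*} [Field L] (F : Subfield L) {v : L} (hv : v ≠ 0)
    {q a b m : ℕ} (hab : q * b = 1 + m * a) (h1 : v ^ q ∈ F) (h2 : v ^ a ∈ F) : v ∈ F := by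
  have : v = (v ^ q) ^ b / (v ^ a) ^ m := by
    rw [eq_div_iff (pow_ne_zero _ (pow_ne_zero _ hv)), ← pow_mul, ← pow_mul, hab, mul_comm a m,
      pow_add, pow_one]
  rw [this]
  exact div_mem (pow_mem h1 b) (pow_mem h2 m)

/-- The substitution used where y vanishes and g is invertible: it makes a unit multiple of y a q-th
power. `mul_pow_eq_of_le` is its counterpart where y is invertible. -/
theorem mul_pow_eq_of_coprime {L : Type*} [Field L] {v y g : L} {q a b m : ℕ}
    (hab : q * b = 1 + m * a) (h : v ^ q * y ^ m = g) : (v ^ a * y ^ b) ^ q = y * g ^ a := by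
  rw [← h, mul_pow, mul_pow, ← pow_mul, ← pow_mul, ← pow_mul, ← pow_mul, mul_comm b q, hab,
    mul_comm a q, pow_add, pow_one]
  ring

theorem mul_pow_eq_of_le {L : Type*} [Field L] {v y g : L} {q m : ℕ} (hq : 1 ≤ q)
    (h : v ^ q * y ^ m = g) : (v * y ^ m) ^ q = y ^ (q * m - m) * g := by
  have : q * m = (q * m - m) + m := (Nat.sub_add_cancel (Nat.le_mul_of_pos_left m hq)).symm
  rw [← h, mul_pow, ← pow_mul, mul_comm m q, this, pow_add, Nat.add_sub_cancel]
  ring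

theorem IsProductField.perm {k L : Type u} [Field k] [Field L] [Algebra k L] {n m q : ℕ} {t : L}
    {x u : Fin n → L} (h : IsProductField k m q t x u) (π : Equiv.Perm (Fin n)) :
    IsProductField k m q t (x ∘ π) (u ∘ π) where
  rel i := h.rel (π i)
  indep := by
    convert h.indep.comp (Option.map π) (Option.map_injective π.injective) using 1
    funext i
    rcases i with _ | i <;> rfl
  gen F h1 h2 h3 h4 := h.gen F h1 h2 (fun i => by simpa using h3 (π.symm i))
    fun i => by simpa using h4 (π.symm i)

/-! ### Invertibility on the locus d ≠ 0, and the chart Y₀ ≠ 0 -/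

section Charts

variable {k L : Type u} [Field k] [Field L] [Algebra k L] {n m p e a b : ℕ} {t : L}
  {x u : Fin n → L}

theorem smul_eq_zero_of_dvd {A M : Type*} [CommRing A] [AddCommGroup M] [Module A M] {d g : A}
    (hd : ∀ y : M, d • y = 0 → y = 0) (hg : g ∣ d) (N : ℕ) {y : M}
    (hy : g ^ N • y = 0) : y = 0 := by
  have h1 : ∀ y : M, g • y = 0 → y = 0 := fun y h => by
    obtain ⟨c, rfl⟩ := hg
    exact hd y (by rw [mul_comm, mul_smul, h, smul_zero])
  induction N with
  | zero => simpa using hy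
  | succ N ih => exact ih (h1 _ (by rwa [smul_smul, ← pow_succ']))

theorem eq_zero_of_neg_mul_pow_smul {A M : Type*} [CommRing A] [AddCommGroup M] [Module A M]
    {d g : A} (hd : ∀ y : M, d • y = 0 → y = 0) (hg : g ∣ d) (hm : IsUnit (m : A)) (N : ℕ) {y : M}
    (hy : (-m * g ^ N : A) • y = 0) : y = 0 := by
  rw [mul_smul, hm.neg.smul_eq_zero] at hy
  exact smul_eq_zero_of_dvd hd hg N hy

theorem isUnit_natCast_mvPolynomial {σ : Type*} [CharP k p] (hpm : ¬ p ∣ m) :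
    IsUnit (m : MvPolynomial σ k) := by
  have h : (m : k) ≠ 0 := fun h => hpm ((CharP.cast_eq_zero_iff k p m).mp h)
  simpa using h.isUnit.map (MvPolynomial.C (σ := σ))

theorem one_add_mul_X_pow_ne_zero {σ : Type*} (hm : m ≠ 0) (f : MvPolynomial σ k) (i : σ) :
    (1 + f * .X i ^ m : MvPolynomial σ k) ≠ 0 := by
  intro h
  simpa [hm] using congrArg MvPolynomial.constantCoeff h

theorem one_add_notMem {A B : Type*} [CommRing A] [CommRing B] [Algebra k A] [Algebra k B]
    {f : A →ₐ[k] B} (P : Ideal B) [hP : P.IsPrime] {y : A} (hy : f y ∈ P) (hm : m ≠ 0) (s : A) :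
    f (1 + s * y ^ m) ∉ P := by
  intro h
  rw [map_add, map_one, map_mul, map_pow] at h
  refine hP.ne_top ((Ideal.eq_top_iff_one P).mpr ?_)
  exact (P.add_mem_iff_left (P.mul_mem_left _ (P.pow_mem_of_mem hy m (by omega)))).mp h

/-- The chart `Y₀ ≠ 0` is regular. -/
theorem IsProductField.isRegularLocalRing_chart [Fact p.Prime] [CharP k p]
    (h : IsProductField k m (p ^ e) t x u) (he : 1 ≤ e) (hm : 2 ≤ m) (hpm : ¬ p ∣ m)
    (hab : p ^ e * b = 1 + m * a)
    (θ : MvPolynomial (Option (Fin n)) k →ₐ[k] L)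
    (hθ : ∀ i, θ (.X i) = i.elim t fun i => (x i)⁻¹) (R : Subalgebra k L)
    (hR : ∀ f, f ∈ R ↔ θ.toRingHom.IsIntegralElem f) (P : Ideal R) [P.IsPrime] :
    IsRegularLocalRing (Localization.AtPrime P) := by
  classical
  have hq2 : 2 ≤ p ^ e := (Nat.Prime.two_le Fact.out).trans (Nat.le_self_pow (by omega) p)
  have hq : ((p ^ e : ℕ) : MvPolynomial (Option (Fin n)) k) = 0 := by
    rw [Nat.cast_pow, CharP.cast_eq_zero, zero_pow (by omega)]
  have hx0 : ∀ i, x i ≠ 0 := fun i => h.indep.ne_zero (some i)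
  have hinj : Function.Injective θ := by
    have h1 : AlgebraicIndependent k fun i => θ (.X i) :=
      algebraicIndependent_of_generates h.indep (fun i => θ (.X i)) (q := p ^ e) (by omega)
        fun F h1 h2 h3 => by
        have ht : t ∈ F := by simpa [hθ] using h2 none
        have hx : ∀ i, x i ∈ F := fun i => by simpa [hθ] using h2 (some i)
        exact h.gen F h1 ht hx fun i => h3 _ (by rw [h.rel]; exact add_mem (pow_mem (hx i) m) ht)
    have h2 : θ = MvPolynomial.aeval fun i => θ (.X i) := MvPolynomial.algHom_ext fun i => by simp
    rw [h2]
    exact h1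
  have hrel : ∀ i, u i ^ p ^ e * (x i)⁻¹ ^ m = 1 + t * (x i)⁻¹ ^ m := fun i => by
    rw [h.rel, add_mul, inv_pow, mul_inv_cancel₀ (pow_ne_zero m (hx0 i))]
  -- I consists of the indices with yᵢ = 0 at P. For these gᵢ is invertible at P, for the others yᵢ
  -- is, and d is the product of these invertible functions.
  let I : Set (Fin n) := {i | toClosure θ R hR (.X (some i)) ∈ P}
  let g : Fin n → MvPolynomial (Option (Fin n)) k := fun i => 1 + .X none * .X (some i) ^ m
  let ψ : Option (Fin n) → MvPolynomial (Option (Fin n)) k := fun i => i.elim (.X none) fun i =>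
    if i ∈ I then .X (some i) * g i ^ a else .X (some i) ^ (p ^ e * m - m) * g i
  let w : Option (Fin n) → L := fun i => i.elim t fun i =>
    if i ∈ I then u i ^ a * (x i)⁻¹ ^ b else u i * (x i)⁻¹ ^ m
  let d : MvPolynomial (Option (Fin n)) k := ∏ i, if i ∈ I then g i else .X (some i)
  have hdvd : ∀ i, (if i ∈ I then g i else .X (some i)) ∣ d := fun i =>
    Finset.dvd_prod_of_mem _ (Finset.mem_univ i)
  have hu0 : ∀ i, u i ≠ 0 := fun i hi => by
    refine one_add_mul_X_pow_ne_zero (k := k) (by omega : m ≠ 0) (.X none) (some i) (hinj ?_)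
    simp only [map_add, map_one, map_mul, map_pow, hθ, Option.elim, map_zero]
    rw [← hrel, hi, zero_pow (by omega), zero_mul]
  refine isRegularLocalRing_of_chart (p := p) (e := e) θ hinj R hR ψ w
    (fun i : Option (Fin n) => i.elim 1 fun _ => p ^ e) ?_ ?_ d ?_ ?_ P ?_
  · rintro (_ | i) <;> simp
  · rintro (_ | i)
    · simp [w, ψ, hθ]
    · have h0 := hx0 i
      by_cases hi : i ∈ I
      · simp only [Option.elim, w, ψ, g, if_pos hi, map_add, map_one, map_mul, map_pow, hθ]
        exact mul_pow_eq_of_coprime hab (hrel i)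
      · simp only [Option.elim, w, ψ, g, if_neg hi, map_add, map_one, map_mul, map_pow, hθ]
        exact mul_pow_eq_of_le (by omega) (hrel i)
  · intro M _ _ _ _ D hd hψ
    have ht : D (.X none) = 0 := hψ none
    rintro (_ | i)
    · exact ht
    · have h1 := hψ (some i)
      have h2 := hdvd i
      by_cases hi : i ∈ I
      · simp only [Option.elim, ψ, if_pos hi] at h1 h2
        have h3 := derivation_mul_pow D (y := .X (some i)) ht (by omega : m ≠ 0) hq hab
        rw [h1, smul_zero] at h3
        exact smul_eq_zero_of_dvd hd h2 a h3.symm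
      · simp only [Option.elim, ψ, if_neg hi] at h1 h2
        have h3 := derivation_pow_mul D (y := .X (some i)) ht (by omega : m ≠ 0) hq2 hq
        rw [h1] at h3
        exact eq_zero_of_neg_mul_pow_smul hd h2 (isUnit_natCast_mvPolynomial hpm) _ h3.symm
  · intro F h1 h2 h3
    have ht : t ∈ F := by simpa [hθ] using h2 none
    have hx : ∀ i, x i ∈ F := fun i => by simpa [hθ] using h2 (some i)
    refine h.gen F h1 ht hx fun i => ?_
    have h4 := h3 (some i)
    by_cases hi : i ∈ I
    · simp only [Option.elim, w, if_pos hi] at h4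
      refine mem_of_pow_mem F (hu0 i) hab (by rw [h.rel]; exact add_mem (pow_mem (hx i) m) ht) ?_
      have h5 := mul_mem h4 (pow_mem (hx i) b)
      rwa [mul_assoc, ← mul_pow, inv_mul_cancel₀ (hx0 i), one_pow, mul_one] at h5
    · simp only [Option.elim, w, if_neg hi] at h4
      have h5 := mul_mem h4 (pow_mem (hx i) m)
      rwa [mul_assoc, ← mul_pow, inv_mul_cancel₀ (hx0 i), one_pow, mul_one] at h5
  · rw [map_prod]
    intro hmem
    obtain ⟨i, -, hi⟩ := (Ideal.IsPrime.prod_mem_iff (hp := inferInstance)).mp hmem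
    by_cases hiI : i ∈ I
    · rw [if_pos hiI] at hi
      exact one_add_notMem P hiI (by omega) _ hi
    · rw [if_neg hiI] at hi
      exact hiI hi

end Charts

/-! ### The charts at infinity -/

/-- The spectrum of `R` at `P` and `𝔸ⁿ / (1/q)(a₁, …, aₙ) × 𝔸¹` at a point of the vertex line have a
common affine étale neighbourhood over `k`. -/
def IsToricAt (k : Type u) {R : Type u} [Field k] [CommRing R] [Algebra k R]
    (P : Ideal R) {n : ℕ} (q : ℕ) (α : Fin n → ℤ) : Prop :=
  ∃ (S : Type u) (_ : CommRing S) (ι : R →+* S) (φ : Polynomial (QuotRing k q α) →+* S)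
    (Q : PrimeSpectrum S), ι.Etale ∧ φ.Etale ∧
      ι.comp (algebraMap k R) = φ.comp (algebraMap k _) ∧
      (Q.comap ι).asIdeal = P ∧ Q.comap φ ∈ vertexLine k q α

/-- The case T = k[σ^∨ ∩ M][u] of `exists_etale_localization`, with T mapped to L by `toricHom`. The
ψ (some i) are the images of the xᵢ^q, so `hψ` places the point over the vertex, while the remaining
coordinate ψ none runs along the line. -/
theorem isToricAt_of_chart {k L : Type u} [Field k] [Field L] [Algebra k L] {n p e : ℕ} [NeZero n]
    [Fact p.Prime] [CharP k p] (θ : MvPolynomial (Option (Fin n)) k →ₐ[k] L)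
    (hθ : Function.Injective θ) (R : Subalgebra k L)
    (hR : ∀ f, f ∈ R ↔ θ.toRingHom.IsIntegralElem f)
    (ψ : Option (Fin n) → MvPolynomial (Option (Fin n)) k) (α : Fin n → ℤ) (hα : α 0 = 1)
    (ξ : L) (hξ : ξ ≠ 0) (g : Fin n → L) (hg : g 0 = 1) (v : L)
    (hv : v ^ p ^ e = θ (ψ none)) (hw : ∀ i, ξ ^ α i * g i ^ p ^ e = θ (ψ (some i)))
    (d : MvPolynomial (Option (Fin n)) k)
    (hder : ∀ (M : Type u) [AddCommGroup M] [Module k M]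
      [Module (MvPolynomial (Option (Fin n)) k) M]
      [IsScalarTower k (MvPolynomial (Option (Fin n)) k) M]
      (D : Derivation k (MvPolynomial (Option (Fin n)) k) M),
      (∀ x : M, d • x = 0 → x = 0) → (∀ i, D (ψ i) = 0) → ∀ i, D (.X i) = 0)
    (hgen : ∀ F : Subfield L, (∀ c, algebraMap k L c ∈ F) → (∀ i, θ (.X i) ∈ F) →
      v ∈ F → (∀ i, ∃ z : ℤ, ξ ^ z * g i ∈ F) → F = ⊤) (P : Ideal R) [hP : P.IsPrime]
    (hd : toClosure θ R hR d ∉ P) (hψ : ∀ i, toClosure θ R hR (ψ (some i)) ∈ P) :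
    IsToricAt k P (p ^ e) α := by
  have : CharP L p := charP_of_injective_algebraMap (algebraMap k L).injective p
  have : NeZero (p ^ e) := ⟨pow_ne_zero _ (Nat.Prime.ne_zero Fact.out)⟩
  obtain ⟨S, hRS, φ, hφ, hφχ, r, hr, hloc⟩ := exists_etale_localization (p := p) (e := e) θ hθ R hR
    (MvPolynomial.aeval ψ) (basePowers (p ^ e) α k) (toricHom k ξ hξ g v) (by
      rintro (_ | i)
      · rw [toricHom_basePowers_none, hv, MvPolynomial.aeval_X]
      · rw [toricHom_basePowers_some, hw, MvPolynomial.aeval_X])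
    (exists_basePowers_eq_pow k p e) d
    (fun h => hd (by
      rw [show toClosure θ R hR d = 0 from Subtype.ext h]; exact zero_mem _))
    (fun M _ _ _ _ D h1 h2 => hder M D h1 (by simpa using h2))
    (fun F h1 h2 h3 => hgen F h1 h2 (by simpa [toricHom_X] using h3 .X) fun i => by
      obtain ⟨s, z, hs⟩ := exists_toricHom_eq (q := p ^ e) k hα ξ hξ g hg v i
      exact ⟨z, hs ▸ h3 s⟩)
  obtain rfl : r = toClosure θ R hR d := Subtype.ext hr
  let := (Subalgebra.inclusion hRS).toRingHom.toAlgebra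
  have := hloc
  have hdisj : Disjoint (Submonoid.powers (toClosure θ R hR d) : Set R) (P : Set R) := by
    rw [Set.disjoint_left]
    rintro _ ⟨n, rfl⟩ hn
    exact hd (hP.mem_of_pow_mem n hn)
  have hQ := IsLocalization.isPrime_of_isPrime_disjoint (.powers (toClosure θ R hR d)) S P hP hdisj
  have hc : (P.map (algebraMap R S)).comap (algebraMap R S) = P :=
    IsLocalization.under_map_of_isPrime_disjoint (.powers (toClosure θ R hR d)) S hP hdisj
  refine ⟨S, inferInstance, algebraMap R S, φ, ⟨_, hQ⟩, ?_, hφ, ?_, hc, ?_⟩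
  · have : Algebra.Etale R S := Algebra.Etale.of_isLocalizationAway (toClosure θ R hR d)
    exact RingHom.etale_algebraMap.mpr this
  · refine RingHom.ext fun c => Subtype.ext ?_
    rw [RingHom.comp_apply, RingHom.comp_apply, hφχ, AlgHom.commutes]
    rfl
  · refine mem_vertexLine k _ fun i => ?_
    change φ _ ∈ P.map (algebraMap R S)
    have h1 : φ (basePowers (p ^ e) α k (.X (some i))) =
        algebraMap R S (toClosure θ R hR (ψ (some i))) := by
      refine Subtype.ext ?_
      rw [hφχ, toricHom_basePowers_some, hw]
      rfl
    rw [h1]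
    exact Ideal.mem_map_of_mem _ (hψ i)

/-! ### Toric points at infinity -/

section Infinity

variable {k L : Type u} [Field k] [Field L] [Algebra k L] {n m q p e a b : ℕ} {t : L}
  {x u : Fin n → L}

theorem IsProductField.ne_zero (h : IsProductField k m q t x u) (i : Fin n) : x i ≠ 0 :=
  h.indep.ne_zero (some i)

variable [NeZero n]

theorem IsProductField.eq_top_of_infinity (h : IsProductField k m q t x u) {F : Subfield L}
    (h1 : ∀ c, algebraMap k L c ∈ F) (hx : ∀ i, x i ∈ F) (hu0 : u 0 ∈ F)
    (hv : ∀ i, i ≠ 0 → u i - u 0 ∈ F) : F = ⊤ := by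
  refine h.gen F h1 ?_ hx fun i => ?_
  · have h4 := sub_mem (pow_mem hu0 q) (pow_mem (hx 0) m)
    rwa [h.rel, add_sub_cancel_left] at h4
  · by_cases hi : i = 0
    · rwa [hi]
    · simpa using add_mem (hv i hi) hu0

theorem IsProductField.mem_of_infinity (h : IsProductField k m q t x u) {F : Subfield L}
    (θ : MvPolynomial (Option (Fin n)) k →ₐ[k] L)
    (hθ0 : θ (.X (some 0)) = x 0) (hθ : ∀ i, i ≠ 0 → θ (.X (some i)) = x 0 / x i)
    (h2 : ∀ i, θ (.X i) ∈ F) (i : Fin n) : x i ∈ F := by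
  have hx0 : x 0 ∈ F := hθ0 ▸ h2 (some 0)
  by_cases hi : i = 0
  · rwa [hi]
  · have h4 := div_mem hx0 (hθ i hi ▸ h2 (some i))
    rwa [div_div_cancel₀ (h.ne_zero 0)] at h4

theorem IsProductField.injective_of_infinity (hq : 0 < q) (h : IsProductField k m q t x u)
    (θ : MvPolynomial (Option (Fin n)) k →ₐ[k] L) (hθn : θ (.X none) = u 0 ^ q)
    (hθ0 : θ (.X (some 0)) = x 0) (hθ : ∀ i, i ≠ 0 → θ (.X (some i)) = x 0 / x i) :
    Function.Injective θ := by
  have h1 : AlgebraicIndependent k fun i => θ (.X i) :=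
    algebraicIndependent_of_generates h.indep (fun i => θ (.X i)) hq
      fun F h1 h2 h3 => by
        have hx := h.mem_of_infinity θ hθ0 hθ h2
        have hu0 : u 0 ^ q ∈ F := hθn ▸ h2 none
        have ht : t ∈ F := by
          have h4 := sub_mem hu0 (pow_mem (hx 0) m)
          rwa [h.rel, add_sub_cancel_left] at h4
        exact h.gen F h1 ht hx fun i => h3 _ (by rw [h.rel]; exact add_mem (pow_mem (hx i) m) ht)
  have h2 : θ = MvPolynomial.aeval fun i => θ (.X i) := MvPolynomial.algHom_ext fun i => by simp
  rw [h2]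
  exact h1

variable [Fact p.Prime] [CharP k p]

/-- Frobenius cancels t: (uᵢ - u₀)^q = xᵢ^m - x₀^m. This is the analogue of uᵢ^q yᵢ^m = 1 + t yᵢ^m,
with -1 in place of t and the additional factor x₀^m that causes the singularities. -/
theorem IsProductField.sub_pow_mul (h : IsProductField k m (p ^ e) t x u) (i : Fin n) :
    (u i - u 0) ^ p ^ e * (x 0 / x i) ^ m = x 0 ^ m * (1 + -1 * (x 0 / x i) ^ m) := by
  have : CharP L p := charP_of_injective_algebraMap (algebraMap k L).injective p
  have := pow_ne_zero m (h.ne_zero i)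
  rw [sub_pow_char_pow, h.rel, h.rel, div_pow]
  field_simp
  ring

theorem IsProductField.sub_pow_mem (h : IsProductField k m (p ^ e) t x u) {F : Subfield L}
    (hx : ∀ i, x i ∈ F) (i : Fin n) : (u i - u 0) ^ p ^ e ∈ F := by
  have : CharP L p := charP_of_injective_algebraMap (algebraMap k L).injective p
  rw [sub_pow_char_pow, h.rel, h.rel, add_sub_add_right_eq_sub]
  exact sub_mem (pow_mem (hx i) m) (pow_mem (hx 0) m)

theorem IsProductField.sub_ne_zero (h : IsProductField k m (p ^ e) t x u) (hm : m ≠ 0)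
    (θ : MvPolynomial (Option (Fin n)) k →ₐ[k] L) (hinj : Function.Injective θ)
    (hθ : ∀ i, i ≠ 0 → θ (.X (some i)) = x 0 / x i) {i : Fin n} (hi : i ≠ 0) :
    u i - u 0 ≠ 0 := by
  intro h0
  have h1 := h.sub_pow_mul i
  rw [h0, zero_pow (pow_ne_zero _ (Nat.Prime.ne_zero Fact.out)), zero_mul, eq_comm, mul_eq_zero,
    or_iff_right (pow_ne_zero m (h.ne_zero 0)), ← hθ i hi] at h1
  exact one_add_mul_X_pow_ne_zero (k := k) hm (-1) (some i) (hinj (by simpa using h1))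

/-- At a point at infinity where each of the functions `zᵢ (1 - zᵢ^m)` vanishes, the chart is étale
locally toric. -/
theorem IsProductField.isToricAt_infinity (h : IsProductField k m (p ^ e) t x u) (he : 1 ≤ e)
    (hm : 2 ≤ m) (hpm : ¬ p ∣ m) (hab : p ^ e * b = 1 + m * a)
    (θ : MvPolynomial (Option (Fin n)) k →ₐ[k] L) (hθn : θ (.X none) = u 0 ^ p ^ e)
    (hθ0 : θ (.X (some 0)) = x 0) (hθ : ∀ i, i ≠ 0 → θ (.X (some i)) = x 0 / x i)
    (R : Subalgebra k L) (hR : ∀ f, f ∈ R ↔ θ.toRingHom.IsIntegralElem f) (P : Ideal R)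
    [hP : P.IsPrime] (hP0 : toClosure θ R hR (.X (some 0)) ∈ P)
    (hS : ∀ i, i ≠ 0 → toClosure θ R hR (.X (some i)) ∉ P →
      toClosure θ R hR (1 + -1 * .X (some i) ^ m) ∈ P) :
    ∃ α : Fin n → ℤ, α 0 = 1 ∧ (∀ i, i ≠ 0 → α i = 1 ∨ α i = -(m : ℤ)) ∧
      IsToricAt k P (p ^ e) α := by
  classical
  have hq2 : 2 ≤ p ^ e := (Nat.Prime.two_le Fact.out).trans (Nat.le_self_pow (by omega) p)
  have hq : ((p ^ e : ℕ) : MvPolynomial (Option (Fin n)) k) = 0 := by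
    rw [Nat.cast_pow, CharP.cast_eq_zero, zero_pow (by omega)]
  have hinj := h.injective_of_infinity (by omega) θ hθn hθ0 hθ
  have hx0 := h.ne_zero
  have hv0 : ∀ i, i ≠ 0 → u i - u 0 ≠ 0 := fun i => h.sub_ne_zero (by omega) θ hinj hθ
  let I : Set (Fin n) := {i | toClosure θ R hR (.X (some i)) ∈ P}
  let f : Fin n → MvPolynomial (Option (Fin n)) k := fun i => 1 + -1 * .X (some i) ^ m
  let ψ : Option (Fin n) → MvPolynomial (Option (Fin n)) k := fun i => i.elim (.X none) fun i =>
    if i = 0 then .X (some 0) else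
    if i ∈ I then .X (some i) * f i ^ a else .X (some i) ^ (p ^ e * m - m) * f i
  -- For i ≠ 0 put zᵢ = x₀ / xᵢ and fᵢ = 1 - zᵢ^m. If zᵢ ∈ P, then (uᵢ - u₀)^q (zᵢ/x₀)^m = fᵢ gives
  -- gᵢ^q = (zᵢ/x₀) fᵢ^a. Otherwise gᵢ^q = x₀^m zᵢ^(qm-m) fᵢ. The weight αᵢ is the power of x₀ that
  -- turns gᵢ^q into ψᵢ.
  let α : Fin n → ℤ := fun i => if i = 0 ∨ i ∈ I then 1 else -m
  let g : Fin n → L := fun i => if i = 0 then 1 else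
    if i ∈ I then (u i - u 0) ^ a * (x 0 / x i / x 0) ^ b else (u i - u 0) * (x 0 / x i) ^ m
  let d : MvPolynomial (Option (Fin n)) k :=
    ∏ i, if i = 0 then 1 else if i ∈ I then f i else .X (some i)
  have hdvd : ∀ i, (if i = 0 then 1 else if i ∈ I then f i else .X (some i)) ∣ d := fun i =>
    Finset.dvd_prod_of_mem _ (Finset.mem_univ i)
  refine ⟨α, by simp [α], fun i hi => ?_, isToricAt_of_chart (p := p) (e := e) θ hinj R hR ψ α
    (by simp [α]) (x 0) (hx0 0) g (by simp [g]) (u 0) hθn.symm ?_ d ?_ ?_ P ?_ ?_⟩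
  · simp only [α, hi, false_or]
    split_ifs <;> simp
  · intro i
    by_cases hi : i = 0
    · subst hi
      simp [α, g, ψ, hθ0]
    · have h1 := h.sub_pow_mul i
      by_cases hiI : i ∈ I
      · simp only [α, g, ψ, f, Option.elim, hi, hiI, if_false, if_true, or_true, map_mul, map_pow,
          map_add, map_one, map_neg, hθ i hi, zpow_one]
        rw [mul_pow_eq_of_coprime (g := 1 + -1 * (x 0 / x i) ^ m) hab]
        · rw [← mul_assoc, mul_div_cancel₀ _ (hx0 0)]
        · rw [div_pow, ← mul_div_assoc, h1, mul_div_cancel_left₀ _ (pow_ne_zero m (hx0 0))]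
      · simp only [α, g, ψ, f, Option.elim, hi, hiI, if_false, or_false, map_mul, map_pow,
          map_add, map_one, map_neg, hθ i hi, zpow_neg, zpow_natCast]
        rw [mul_pow_eq_of_le (by omega) h1]
        have := pow_ne_zero m (hx0 0)
        field_simp
  · intro M _ _ _ _ D hd hψ
    rintro (_ | i)
    · exact hψ none
    · have h1 := hψ (some i)
      have h2 := hdvd i
      have hs : D (-1) = 0 := by rw [map_neg, D.map_one_eq_zero, neg_zero]
      by_cases hi : i = 0
      · subst hi
        simpa [ψ] using h1
      by_cases hiI : i ∈ I
      · simp only [Option.elim, ψ, hi, if_false, if_pos hiI] at h1 h2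
        have h3 := derivation_mul_pow D (y := .X (some i)) hs (by omega : m ≠ 0) hq hab
        rw [h1, smul_zero] at h3
        exact smul_eq_zero_of_dvd hd h2 a h3.symm
      · simp only [Option.elim, ψ, hi, if_false, if_neg hiI] at h1 h2
        have h3 := derivation_pow_mul D (y := .X (some i)) hs (by omega : m ≠ 0) hq2 hq
        rw [h1] at h3
        exact eq_zero_of_neg_mul_pow_smul hd h2 (isUnit_natCast_mvPolynomial hpm) _ h3.symm
  · intro F h1 h2 hu0 h3
    have hx := h.mem_of_infinity θ hθ0 hθ h2
    refine h.eq_top_of_infinity h1 hx hu0 fun i hi => ?_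
    obtain ⟨z, hz⟩ := h3 i
    have hgi : g i ∈ F := by
      have h4 := mul_mem (inv_mem (zpow_mem (hx 0) z)) hz
      rwa [inv_mul_cancel_left₀ (zpow_ne_zero z (hx0 0))] at h4
    by_cases hiI : i ∈ I
    · simp only [g, hi, if_false, if_pos hiI] at hgi
      refine mem_of_pow_mem F (hv0 i hi) hab (h.sub_pow_mem hx i) ?_
      have h4 := div_mem hgi (pow_mem (div_mem (div_mem (hx 0) (hx i)) (hx 0)) b)
      rwa [mul_div_cancel_right₀ _ (pow_ne_zero b
        (div_ne_zero (div_ne_zero (hx0 0) (hx0 i)) (hx0 0)))] at h4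
    · simp only [g, hi, if_false, if_neg hiI] at hgi
      have h4 := div_mem hgi (pow_mem (div_mem (hx 0) (hx i)) m)
      rwa [mul_div_cancel_right₀ _ (pow_ne_zero m (div_ne_zero (hx0 0) (hx0 i)))] at h4
  · rw [map_prod]
    intro hmem
    obtain ⟨i, -, hi⟩ := (Ideal.IsPrime.prod_mem_iff (hp := hP)).mp hmem
    by_cases hi0 : i = 0
    · rw [if_pos hi0, map_one] at hi
      exact hP.ne_top ((Ideal.eq_top_iff_one P).mpr hi)
    rw [if_neg hi0] at hi
    by_cases hiI : i ∈ I
    · rw [if_pos hiI] at hi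
      exact one_add_notMem P hiI (by omega) _ hi
    · rw [if_neg hiI] at hi
      exact hiI hi
  · intro i
    by_cases hi : i = 0
    · simpa [ψ, hi] using hP0
    by_cases hiI : i ∈ I
    · simp only [Option.elim, ψ, hi, if_false, if_pos hiI, map_mul]
      exact P.mul_mem_right _ hiI
    · simp only [Option.elim, ψ, hi, if_false, if_neg hiI]
      rw [map_mul]
      exact P.mul_mem_left _ (hS i hi hiI)

end Infinity

/-! ### Regular points at infinity -/

section RegularInfinity

variable {k L : Type u} [Field k] [Field L] [Algebra k L] {n m p e a b : ℕ} {t : L}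
  {x u : Fin n → L} [NeZero n] [Fact p.Prime] [CharP k p]

/-- A point at infinity where one of the functions `zⱼ (1 - zⱼ^m)` does not vanish is regular. -/
theorem IsProductField.isRegularLocalRing_infinity (h : IsProductField k m (p ^ e) t x u)
    (he : 1 ≤ e) (hm : 2 ≤ m) (hpm : ¬ p ∣ m) (hab : p ^ e * b = 1 + m * a)
    (θ : MvPolynomial (Option (Fin n)) k →ₐ[k] L) (hθn : θ (.X none) = u 0 ^ p ^ e)
    (hθ0 : θ (.X (some 0)) = x 0) (hθ : ∀ i, i ≠ 0 → θ (.X (some i)) = x 0 / x i)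
    (R : Subalgebra k L) (hR : ∀ f, f ∈ R ↔ θ.toRingHom.IsIntegralElem f) (P : Ideal R)
    [hP : P.IsPrime] (j : Fin n) (hj : j ≠ 0) (hj1 : toClosure θ R hR (.X (some j)) ∉ P)
    (hj2 : toClosure θ R hR (1 + -1 * .X (some j) ^ m) ∉ P) :
    IsRegularLocalRing (Localization.AtPrime P) := by
  classical
  have hq2 : 2 ≤ p ^ e := (Nat.Prime.two_le Fact.out).trans (Nat.le_self_pow (by omega) p)
  have hq : ((p ^ e : ℕ) : MvPolynomial (Option (Fin n)) k) = 0 := by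
    rw [Nat.cast_pow, CharP.cast_eq_zero, zero_pow (by omega)]
  have hinj := h.injective_of_infinity (by omega) θ hθn hθ0 hθ
  have hx0 := h.ne_zero
  have hv0 : ∀ i, i ≠ 0 → u i - u 0 ≠ 0 := fun i => h.sub_ne_zero (by omega) θ hinj hθ
  have hf0 : 1 + -1 * (x 0 / x j) ^ m ≠ 0 := by
    have h1 := (map_ne_zero_iff θ hinj).mpr
      (one_add_mul_X_pow_ne_zero (k := k) (by omega : m ≠ 0) (-1) (some j))
    simpa [hθ j hj] using h1
  let I : Set (Fin n) := {i | toClosure θ R hR (.X (some i)) ∈ P}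
  let f : Fin n → MvPolynomial (Option (Fin n)) k := fun i => 1 + -1 * .X (some i) ^ m
  -- c is invertible at P and r^q x₀^m = c. Thus r and x₀ satisfy an equation of the shape v^q y^m =
  -- unit, and (r (uᵢ - u₀))^q zᵢ^m = c fᵢ no longer contains x₀.
  let c : MvPolynomial (Option (Fin n)) k := .X (some j) ^ m * f j ^ (p ^ e - 1)
  let r : L := (1 + -1 * (x 0 / x j) ^ m) / (u j - u 0)
  have hr0 : r ≠ 0 := div_ne_zero hf0 (hv0 j hj)
  have hr : r ^ p ^ e * x 0 ^ m = θ c := by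
    have h1 := h.sub_pow_mul j
    simp only [r, c, f, map_mul, map_pow, map_add, map_one, map_neg, hθ j hj]
    rw [div_pow, div_mul_eq_mul_div, div_eq_iff (pow_ne_zero _ (hv0 j hj)),
      ← pow_sub_one_mul (by omega : p ^ e ≠ 0) (1 + -1 * (x 0 / x j) ^ m)]
    linear_combination -(1 + -1 * (x 0 / x j) ^ m) ^ (p ^ e - 1) * h1
  let ψ : Option (Fin n) → MvPolynomial (Option (Fin n)) k := fun i => i.elim (.X none) fun i =>
    if i = 0 then .X (some 0) * c ^ a else if i = j then .X (some j) else
    if i ∈ I then c ^ a * (.X (some i) * f i ^ a)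
    else c * (.X (some i) ^ (p ^ e * m - m) * f i)
  let w : Option (Fin n) → L := fun i => i.elim (u 0) fun i =>
    if i = 0 then r ^ a * x 0 ^ b else if i = j then x 0 / x j else
    if i ∈ I then (r * (u i - u 0)) ^ a * (x 0 / x i) ^ b
    else (r * (u i - u 0)) * (x 0 / x i) ^ m
  let d : MvPolynomial (Option (Fin n)) k := .X (some j) * f j *
    ∏ i, if i = 0 then 1 else if i ∈ I then f i else .X (some i)
  have hdvd : ∀ i, (if i = 0 then 1 else if i ∈ I then f i else .X (some i)) ∣ d := fun i =>
    Dvd.dvd.mul_left (Finset.dvd_prod_of_mem _ (Finset.mem_univ i)) _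
  have hrel : ∀ i, (r * (u i - u 0)) ^ p ^ e * (x 0 / x i) ^ m =
      θ c * (1 + -1 * (x 0 / x i) ^ m) := fun i => by
    rw [mul_pow, mul_assoc, h.sub_pow_mul i, ← mul_assoc, hr]
  -- No root of the coordinate zⱼ is taken: uⱼ - u₀ is recovered as fⱼ / r. A derivation killing zⱼ
  -- kills c, so c is a constant in the remaining coordinates.
  refine isRegularLocalRing_of_chart (p := p) (e := e) θ hinj R hR ψ w
    (fun i : Option (Fin n) => if i = some j then 1 else p ^ e) ?_ ?_ d ?_ ?_ P ?_
  · intro i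
    split_ifs <;> simp
  · rintro (_ | i)
    · simp [w, ψ, hθn]
    by_cases hi : i = 0
    · subst hi
      simp only [w, ψ, Option.elim, if_true, Option.some.injEq, hj.symm, if_false, map_mul, hθ0]
      rw [mul_pow_eq_of_coprime hab hr, map_pow]
    by_cases hij : i = j
    · subst hij
      simp [w, ψ, hi, hθ]
    by_cases hiI : i ∈ I
    · simp only [w, ψ, f, Option.elim, Option.some.injEq, hi, hij, hiI, if_true, if_false]
      rw [mul_pow_eq_of_coprime hab (hrel i)]
      simp only [map_mul, map_pow, map_add, map_one, map_neg, hθ i hi, mul_pow (θ c)]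
      ring
    · simp only [w, ψ, f, Option.elim, Option.some.injEq, hi, hij, hiI, if_false]
      rw [mul_pow_eq_of_le (by omega) (hrel i)]
      simp only [map_mul, map_pow, map_add, map_one, map_neg, hθ i hi]
      ring
  · intro M _ _ _ _ D hd hψ
    have hs : D (-1) = 0 := by rw [map_neg, D.map_one_eq_zero, neg_zero]
    have hDj : D (.X (some j)) = 0 := by simpa [ψ, hj] using hψ (some j)
    have hDc : D c = 0 := by
      simp [c, f, D.leibniz, D.leibniz_pow, hDj]
    have hDca : D (c ^ a) = 0 := by simp [D.leibniz_pow, hDc]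
    have hcs : ∀ (N : ℕ) (y : M), c ^ N • y = 0 → y = 0 := by
      intro N y hy
      rw [mul_pow, ← pow_mul, ← pow_mul, mul_smul] at hy
      exact smul_eq_zero_of_dvd hd ((Dvd.intro_left _ rfl).mul_right _) _
        (smul_eq_zero_of_dvd hd ⟨_, mul_assoc _ _ _⟩ _ hy)
    rintro (_ | i)
    · exact hψ none
    have h1 := hψ (some i)
    have h2 := hdvd i
    by_cases hi : i = 0
    · subst hi
      simp only [Option.elim, ψ, if_true, mul_comm _ (c ^ a)] at h1
      rw [derivation_mul_of_eq_zero D hDca] at h1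
      exact hcs _ _ h1
    by_cases hij : i = j
    · rw [hij]; exact hDj
    by_cases hiI : i ∈ I
    · simp only [Option.elim, ψ, hi, hij, if_false, if_pos hiI] at h1 h2
      rw [derivation_mul_of_eq_zero D hDca] at h1
      have h3 := derivation_mul_pow D (y := .X (some i)) hs (by omega : m ≠ 0) hq hab
      rw [hcs _ _ h1, smul_zero] at h3
      exact smul_eq_zero_of_dvd hd h2 a h3.symm
    · simp only [Option.elim, ψ, hi, hij, if_false, if_neg hiI] at h1 h2
      rw [derivation_mul_of_eq_zero D hDc, ← pow_one c] at h1
      have h3 := derivation_pow_mul D (y := .X (some i)) hs (by omega : m ≠ 0) hq2 hq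
      rw [hcs _ _ h1] at h3
      exact eq_zero_of_neg_mul_pow_smul hd h2 (isUnit_natCast_mvPolynomial hpm) _ h3.symm
  · intro F h1 h2 h3
    have hx := h.mem_of_infinity θ hθ0 hθ h2
    have hu0 : u 0 ∈ F := h3 none
    have hrF : r ∈ F := by
      have h4 := h3 (some 0)
      simp only [Option.elim, w, if_true] at h4
      refine mem_of_pow_mem F hr0 hab ?_ ?_
      · have h5 : r ^ p ^ e = θ c / x 0 ^ m :=
          (eq_div_iff (pow_ne_zero m (hx0 0))).mpr hr
        rw [h5]
        refine div_mem ?_ (pow_mem (hx 0) m)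
        simp only [c, f, map_mul, map_pow, map_add, map_one, map_neg]
        have h6 := h2 (some j)
        exact mul_mem (pow_mem h6 m) (pow_mem (add_mem (one_mem F)
          (mul_mem (neg_mem (one_mem F)) (pow_mem h6 m))) _)
      · have h5 := div_mem h4 (pow_mem (hx 0) b)
        rwa [mul_div_cancel_right₀ _ (pow_ne_zero b (hx0 0))] at h5
    refine h.eq_top_of_infinity h1 hx hu0 fun i hi => ?_
    have hzi := div_mem (hx 0) (hx i)
    have hz0 := div_ne_zero (hx0 0) (hx0 i)
    by_cases hij : i = j
    · subst hij
      have h4 : u i - u 0 = (1 + -1 * (x 0 / x i) ^ m) / r := (div_div_cancel₀ hf0).symm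
      rw [h4]
      exact div_mem (add_mem (one_mem F) (mul_mem (neg_mem (one_mem F)) (pow_mem hzi m))) hrF
    have h4 := h3 (some i)
    have h5 : r * (u i - u 0) ∈ F := by
      by_cases hiI : i ∈ I
      · simp only [Option.elim, w, hi, hij, if_false, if_pos hiI] at h4
        refine mem_of_pow_mem F (mul_ne_zero hr0 (hv0 i hi)) hab ?_ ?_
        · rw [mul_pow]
          exact mul_mem (pow_mem hrF _) (h.sub_pow_mem hx i)
        · have h5 := div_mem h4 (pow_mem hzi b)
          rwa [mul_div_cancel_right₀ _ (pow_ne_zero b hz0)] at h5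
      · simp only [Option.elim, w, hi, hij, if_false, if_neg hiI] at h4
        have h5 := div_mem h4 (pow_mem hzi m)
        rwa [mul_div_cancel_right₀ _ (pow_ne_zero m hz0)] at h5
    have h6 := div_mem h5 hrF
    rwa [mul_div_cancel_left₀ _ hr0] at h6
  · rw [map_mul, map_mul, map_prod]
    intro hmem
    rcases hP.mem_or_mem hmem with hmem | hmem
    · exact (hP.mem_or_mem hmem).elim hj1 hj2
    obtain ⟨i, -, hi⟩ := (Ideal.IsPrime.prod_mem_iff (hp := hP)).mp hmem
    by_cases hi0 : i = 0
    · rw [if_pos hi0, map_one] at hi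
      exact hP.ne_top ((Ideal.eq_top_iff_one P).mpr hi)
    rw [if_neg hi0] at hi
    by_cases hiI : i ∈ I
    · rw [if_pos hiI] at hi
      exact one_add_notMem P hiI (by omega) _ hi
    · rw [if_neg hiI] at hi
      exact hiI hi

end RegularInfinity

/-! ### Singular points of `𝒴` -/

theorem isProductField_funField (k : Type u) [Field k] (p : ℕ) [Fact p.Prime] [CharP k p]
    (n m e : ℕ) (hm : m ≠ 0) (hpm : ¬ p ∣ m) [IsDomain (CoordRing k n m (p ^ e))] :
    IsProductField k m (p ^ e) (tFun k n m (p ^ e)) (x k n m (p ^ e)) (uFun k n m (p ^ e)) where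
  rel := uFun_pow k n m (p ^ e)
  indep := injective_aeval_funField k p n m e hm hpm
  gen := subfield_eq_top k n m (p ^ e)

theorem isIntegralElem_iff_of_adjoin {σ k L : Type*} [Field k] [Field L] [Algebra k L]
    (θ : MvPolynomial σ k →ₐ[k] L) (C : Subalgebra k L)
    (h : Algebra.adjoin k (Set.range fun i => θ (.X i)) = C) (f : L) :
    (algebraMap C L).IsIntegralElem f ↔ θ.toRingHom.IsIntegralElem f := by
  have h1 : θ.range = C := by
    rw [← h, Algebra.adjoin_range_eq_range_aeval]
    congr 1
    exact MvPolynomial.algHom_ext fun i => by simp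
  subst h1
  constructor <;> refine isIntegralElem_of_range_le ?_
  · rintro _ ⟨a, rfl⟩
    exact a.2
  · exact fun a ha => ⟨⟨a, ha⟩, rfl⟩

theorem adjoin_eq_chartRing_zero {k L : Type u} [Field k] [Field L] [Algebra k L] {n : ℕ} (t : L)
    (x : Fin n → L) : Algebra.adjoin k (Set.range fun i : Option (Fin n) =>
      i.elim t fun i => (x i)⁻¹) = chartRing k t (Fin.cons 1 fun i => (x i)⁻¹) 0 := by
  refine le_antisymm (Algebra.adjoin_le ?_) (Algebra.adjoin_le ?_)
  · rintro _ ⟨_ | i, rfl⟩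
    · exact Algebra.subset_adjoin (Or.inl rfl)
    · exact Algebra.subset_adjoin (Or.inr ⟨i.succ, by simp⟩)
  · rintro _ (rfl | ⟨i, rfl⟩)
    · exact Algebra.subset_adjoin ⟨none, rfl⟩
    · refine Fin.cases ?_ (fun i => ?_) i
      · simp [one_mem]
      · exact Algebra.subset_adjoin ⟨some i, by simp⟩

/-- On this chart t and uⱼ^q differ by xⱼ^m, a polynomial in a coordinate, so either may serve as a
variable. The transposition brings j to the index 0 singled out in the analysis at infinity. -/
theorem IsProductField.adjoin_eq_chartRing_succ {k L : Type u} [Field k] [Field L] [Algebra k L]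
    {n m q : ℕ} {t : L} {x u : Fin n → L} (h : IsProductField k m q t x u) [NeZero n] (j : Fin n) :
    Algebra.adjoin k (Set.range fun i : Option (Fin n) => i.elim (u j ^ q) fun i =>
      if i = 0 then x j else x j / x (Equiv.swap 0 j i)) =
      chartRing k t (Fin.cons 1 fun i => (x i)⁻¹) j.succ := by
  have hx0 := h.ne_zero
  refine le_antisymm (Algebra.adjoin_le ?_) (Algebra.adjoin_le ?_)
  · have hxj : x j ∈ chartRing k t (Fin.cons 1 fun i => (x i)⁻¹) j.succ :=
      Algebra.subset_adjoin (Or.inr ⟨0, by simp⟩)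
    rintro _ ⟨_ | i, rfl⟩
    · simp only [Option.elim, h.rel]
      exact add_mem (pow_mem hxj m) (Algebra.subset_adjoin (Or.inl rfl))
    · simp only [Option.elim]
      split_ifs with hi
      · exact hxj
      · exact Algebra.subset_adjoin
          (Or.inr ⟨(Equiv.swap 0 j i).succ, by simp [div_eq_mul_inv, mul_comm]⟩)
  · set A := Algebra.adjoin k (Set.range fun i : Option (Fin n) => i.elim (u j ^ q) fun i =>
      if i = 0 then x j else x j / x (Equiv.swap 0 j i)) with hA
    have hxj : x j ∈ A := Algebra.subset_adjoin ⟨some 0, by simp⟩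
    rintro _ (rfl | ⟨i, rfl⟩)
    · have h1 : u j ^ q ∈ A := Algebra.subset_adjoin ⟨none, rfl⟩
      have h2 := sub_mem h1 (pow_mem hxj m)
      rwa [h.rel, add_sub_cancel_left] at h2
    · refine Fin.cases ?_ (fun i => ?_) i
      · simpa using hxj
      · by_cases hi : i = j
        · subst hi
          simp [hx0, one_mem]
        · refine Algebra.subset_adjoin ⟨some (Equiv.swap 0 j i), ?_⟩
          have h1 : Equiv.swap 0 j i ≠ 0 := fun h1 => hi
            ((Equiv.swap 0 j).injective (h1.trans (Equiv.swap_apply_right 0 j).symm))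
          simp [h1, div_eq_mul_inv, mul_comm]

theorem exists_coprime_relation {p e m : ℕ} [Fact p.Prime] (hm : 2 ≤ m) (hpm : ¬ p ∣ m) :
    ∃ a b : ℕ, p ^ e * b = 1 + m * a := by
  have hc : (p ^ e).Coprime m :=
    Nat.Coprime.pow_left e ((Nat.Prime.coprime_iff_not_dvd Fact.out).mpr hpm)
  obtain ⟨b, hb⟩ := Nat.exists_mul_mod_eq_one_of_coprime hc (by omega)
  -- q b leaves remainder 1 mod m, so a is the quotient.
  refine ⟨p ^ e * b / m, b, ?_⟩
  have := Nat.mod_add_div (p ^ e * b) m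
  omega

theorem isRegularLocalRing_stalk {R : Type u} [CommRing R] {X : Scheme.{u}}
    (J : Spec (.of R) ⟶ X) [IsOpenImmersion J] (z : PrimeSpectrum R)
    (h : IsRegularLocalRing (Localization.AtPrime z.asIdeal)) :
    IsRegularLocalRing (X.presheaf.stalk (J z)) := by
  have h1 : ∀ z : Spec (.of R), IsRegularLocalRing ((Spec (.of R)).presheaf.stalk z) →
      IsRegularLocalRing (X.presheaf.stalk (J z)) := fun z _ =>
    IsRegularLocalRing.of_ringEquiv (asIso (J.stalkMap z)).symm.commRingCatIsoToRingEquiv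
  exact h1 z
    (IsRegularLocalRing.of_ringEquiv (Spec.stalkIso (.of R) z).symm.commRingCatIsoToRingEquiv)

/-- A chart that is toric at a prime gives a common étale neighbourhood. -/
theorem IsToricAt.etaleLocallySame {k R : Type u} [Field k] [CommRing R] [Algebra k R]
    {X : Scheme.{u}} (sX : X ⟶ Spec (.of k)) (J : Spec (.of R) ⟶ X) [IsOpenImmersion J]
    (hJ : J ≫ sX = Spec.map (CommRingCat.ofHom (algebraMap k R))) (z : Spec (.of R)) {n q : ℕ}
    {α : Fin n → ℤ} (h : IsToricAt k (PrimeSpectrum.asIdeal z) q α) :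
    ∃ v ∈ vertexLine k q α, EtaleLocallySame sX (quotToBase k q α) (J z) v := by
  obtain ⟨S, _, ι, φ, Q, hι, hφ, hk, hQ, hv⟩ := h
  have h1 : Etale (Spec.map (CommRingCat.ofHom ι)) :=
    (HasRingHomProperty.Spec_iff (P := @Etale)).mpr hι
  have h2 : Etale (Spec.map (CommRingCat.ofHom φ)) :=
    (HasRingHomProperty.Spec_iff (P := @Etale)).mpr hφ
  refine ⟨_, hv, Spec (.of S), Spec.map (CommRingCat.ofHom ι) ≫ J,
    Spec.map (CommRingCat.ofHom φ), Q, inferInstance, h2, ?_, ?_, rfl⟩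
  · rw [Category.assoc, hJ, quotToBase, ← Spec.map_comp, ← Spec.map_comp, ← CommRingCat.ofHom_comp,
      ← CommRingCat.ofHom_comp, hk]
  · exact congrArg J (PrimeSpectrum.ext hQ)

/-- Every point of `𝒴` is regular or étale locally toric. -/
theorem isRegularLocalRing_or_toric (k : Type u) [Field k] (p : ℕ) [Fact p.Prime] [CharP k p]
    (e m n : ℕ) (he : 1 ≤ e) (hm : 2 ≤ m) (hpm : ¬ p ∣ m) [NeZero n] (y : Y k n m (p ^ e)) :
    IsRegularLocalRing ((Y k n m (p ^ e)).presheaf.stalk y) ∨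
    ∃ α : Fin n → ℤ, α 0 = 1 ∧ (∀ i : Fin n, i ≠ 0 → α i = 1 ∨ α i = -(m : ℤ)) ∧
      ∃ z ∈ vertexLine k (p ^ e) α,
        EtaleLocallySame (YToBase k n m (p ^ e)) (quotToBase k (p ^ e) α) y z := by
  have := isDomain_coordRing k p n m e (by omega) hpm
  have h := isProductField_funField k p n m e (by omega) hpm
  obtain ⟨a, b, hab⟩ := exists_coprime_relation (e := e) hm hpm
  obtain ⟨j, J, z, hJ, rfl, hk, hz⟩ := exists_mem_chart k n m (p ^ e) h.ne_zero
    (fun j => (integralClosure (chartRing k (tFun k n m (p ^ e)) (coord k n m (p ^ e)) j)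
      (FunField k n m (p ^ e))).restrictScalars k) (fun _ _ => Iff.rfl) y
  revert J z
  refine Fin.cases ?_ (fun j => ?_) j
  · intro J z hJ hk hz
    have := PrimeSpectrum.isPrime z
    let θ : MvPolynomial (Option (Fin n)) k →ₐ[k] FunField k n m (p ^ e) :=
      MvPolynomial.aeval fun i => i.elim (tFun k n m (p ^ e)) fun i => (x k n m (p ^ e) i)⁻¹
    have hθ : ∀ i, θ (.X i) = i.elim (tFun k n m (p ^ e)) fun i => (x k n m (p ^ e) i)⁻¹ :=
      fun i => MvPolynomial.aeval_X _ i
    left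
    have hR := isIntegralElem_iff_of_adjoin θ _ ((congrArg (fun f => Algebra.adjoin k (Set.range f))
      (funext hθ)).trans (adjoin_eq_chartRing_zero _ _))
    exact isRegularLocalRing_stalk J z
      (h.isRegularLocalRing_chart he hm hpm hab θ hθ _ hR (PrimeSpectrum.asIdeal z))
  · intro J z hJ hk hz
    have := PrimeSpectrum.isPrime z
    let v : Option (Fin n) → FunField k n m (p ^ e) := fun i =>
      i.elim (uFun k n m (p ^ e) j ^ p ^ e) fun i => if i = 0 then x k n m (p ^ e) j else
        x k n m (p ^ e) j / x k n m (p ^ e) (Equiv.swap 0 j i)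
    let θ : MvPolynomial (Option (Fin n)) k →ₐ[k] FunField k n m (p ^ e) := MvPolynomial.aeval v
    have hθ : ∀ i, θ (.X i) = v i := fun i => MvPolynomial.aeval_X _ i
    have hR := isIntegralElem_iff_of_adjoin θ _ ((congrArg (fun f => Algebra.adjoin k (Set.range f))
      (funext hθ)).trans (h.adjoin_eq_chartRing_succ j))
    have h' := h.perm (Equiv.swap 0 j)
    have hθn : θ (.X none) = (uFun k n m (p ^ e) ∘ Equiv.swap 0 j) 0 ^ p ^ e := by
      simp [hθ, v]
    have hθ0 : θ (.X (some 0)) = (x k n m (p ^ e) ∘ Equiv.swap 0 j) 0 := by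
      simp [hθ, v]
    have hθi : ∀ i, i ≠ 0 → θ (.X (some i)) = (x k n m (p ^ e) ∘ Equiv.swap 0 j) 0 /
        (x k n m (p ^ e) ∘ Equiv.swap 0 j) i := fun i hi => by
      simp [hθ, v, hi]
    have hP0 := hz j rfl (toClosure θ _ hR (.X (some 0))) (hθ (some 0))
    by_cases hS : ∀ i, i ≠ 0 → toClosure θ _ hR (.X (some i)) ∉ PrimeSpectrum.asIdeal z →
        toClosure θ _ hR (1 + -1 * .X (some i) ^ m) ∈ PrimeSpectrum.asIdeal z
    · obtain ⟨α, h0, h1, h2⟩ := h'.isToricAt_infinity he hm hpm hab θ hθn hθ0 hθi _ hR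
        (PrimeSpectrum.asIdeal z) hP0 hS
      exact Or.inr ⟨α, h0, h1, h2.etaleLocallySame _ J hk z⟩
    · push Not at hS
      obtain ⟨i, hi, hi1, hi2⟩ := hS
      exact Or.inl (isRegularLocalRing_stalk J z (h'.isRegularLocalRing_infinity he hm hpm hab θ hθn
        hθ0 hθi _ hR (PrimeSpectrum.asIdeal z) i hi hi1 hi2))

end ProductOfCurves

end

theorem mainTheorem8 {k : Type u} [Field k] [IsAlgClosed k] (p : ℕ) [Fact p.Prime] [CharP k p]
    (e m n : ℕ) (he : 1 ≤ e) (hm : 2 ≤ m) (hpm : ¬ p ∣ m) [NeZero n]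
    (y : ProductOfCurves.Y k n m (p ^ e))
    (hy : ProductOfCurves.IsSingularPt (ProductOfCurves.Y k n m (p ^ e)) y) :
    ∃ a : Fin n → ℤ, a 0 = 1 ∧ (∀ i : Fin n, i ≠ 0 → a i = 1 ∨ a i = -(m : ℤ)) ∧
      ∃ z ∈ ProductOfCurves.vertexLine k (p ^ e) a,
        ProductOfCurves.EtaleLocallySame (ProductOfCurves.YToBase k n m (p ^ e))
          (ProductOfCurves.quotToBase k (p ^ e) a) y z := by
  rcases ProductOfCurves.isRegularLocalRing_or_toric k p e m n he hm hpm y with h | h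
  · exact (hy h).elim
  · exact h
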